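/- Let $H$ be a $16$-dimensional semisimple Hopf algebra over $\mathbb{C}$ such that its dual Hopf algebra $H^*$ has exactly $8$ group-like elements, i.e. $|\mathbf{G}(H^*)|=8$. Let $\pi$ be an irreducible $2$-dimensional representation of $H$. Here representations of $H$ are left $H$-modules over $\mathbb{C}$; the dual $\pi^*=\mathrm{Hom}_{\mathbb{C}}(\pi,\mathbb{C})$ carries the action $(h\cdot f)(v)=f(S(h)v)$, where $S$ is the antipode, and the tensor product over $\mathbb{C}$ of two representations carries the action $h\cdot(x\otimes y)=\sum h_{(1)}x\otimes h_{(2)}y$. A representation of $H$ is called inner-faithful if the only Hopf ideal of $H$ annihilating it is the zero ideal. 1. The representation $\pi$ is inner-faithful if and only if $\pi^*\not\cong\pi$. 2. Suppose that $\pi^*\cong\pi$, and let $\varphi$ be a one-dimensional representation of $H$. Then $\pi\oplus\varphi$ is inner-faithful if and only if $\varphi$ is not isomorphic to a direct summand of $\pi\otimes\pi$. -/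

import Mathlib

open scoped TensorProduct

noncomputable section

universe u v w w'

/-! ### The dual coalgebra of a finite-dimensional algebra -/

/-- The linear dual `H* = Hom(H, k)` of a `k`-algebra `H`, with the coalgebra structure below. -/
abbrev HopfDual (k : Type u) (H : Type v) [Field k] [Ring H] [Algebra k H] : Type (max u v) :=
  Module.Dual k H

namespace HopfDual

variable {k : Type u} {H : Type v} [Field k] [Ring H] [Algebra k H]

variable (k H) in
/-- The canonical pairing `(H* ⊗ H*) → (H ⊗ H)*`, `(f ⊗ g) ↦ (a ⊗ b ↦ f a * g b)`, which is
an isomorphism because `H` is finite-dimensional. -/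
def pairing [Module.Finite k H] :
    HopfDual k H ⊗[k] HopfDual k H ≃ₗ[k] Module.Dual k (H ⊗[k] H) :=
  TensorProduct.dualDistribEquiv k H H

/-- `Δ f` is the element of `H* ⊗ H*` corresponding to `a ⊗ b ↦ f (a * b)`, and
`ε f = f 1`. -/
instance [Module.Finite k H] : CoalgebraStruct k (HopfDual k H) where
  comul := (pairing k H).symm.toLinearMap ∘ₗ (LinearMap.mul' k H).dualMap
  counit := Module.Dual.eval k H 1

lemma counit_def [Module.Finite k H] (f : Module.Dual k H) :
    Coalgebra.counit (R := k) f = f 1 := rfl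

lemma pairing_tmul [Module.Finite k H] (f g : Module.Dual k H) (a b : H) :
    pairing k H (f ⊗ₜ[k] g) (a ⊗ₜ[k] b) =
      f a * g b := rfl

lemma pairing_comul [Module.Finite k H] (f : Module.Dual k H) (a b : H) :
    pairing k H (Coalgebra.comul (R := k) f) (a ⊗ₜ[k] b) = f (a * b) := by
  change pairing k H ((pairing k H).symm ((LinearMap.mul' k H).dualMap f)) (a ⊗ₜ[k] b) = _
  rw [LinearEquiv.apply_symm_apply]
  rfl

/-- The triple pairing `H* ⊗ (H* ⊗ H*) → (H ⊗ (H ⊗ H))*`. -/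
def pairing₃ (k : Type u) (H : Type v) [Field k] [Ring H] [Algebra k H] [Module.Finite k H] :
    HopfDual k H ⊗[k] (HopfDual k H ⊗[k] HopfDual k H) ≃ₗ[k]
      Module.Dual k (H ⊗[k] (H ⊗[k] H)) :=
  (TensorProduct.congr (LinearEquiv.refl k (Module.Dual k H)) (pairing k H)).trans
    (TensorProduct.dualDistribEquiv k H (H ⊗[k] H))

lemma pairing₃_tmul [Module.Finite k H] (f : Module.Dual k H)
    (x : HopfDual k H ⊗[k] HopfDual k H) (a b c : H) :
    pairing₃ k H (f ⊗ₜ[k] x) (a ⊗ₜ[k] (b ⊗ₜ[k] c)) =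
      f a * pairing k H x (b ⊗ₜ[k] c) := rfl

lemma pairing₃_lTensor [Module.Finite k H] (x : HopfDual k H ⊗[k] HopfDual k H) (a b c : H) :
    pairing₃ k H (Coalgebra.comul.lTensor (HopfDual k H) x) (a ⊗ₜ[k] (b ⊗ₜ[k] c)) =
      pairing k H x (a ⊗ₜ[k] (b * c)) := by
  induction x with
  | zero => simp
  | add x y hx hy => simp only [map_add, LinearMap.add_apply, hx, hy]
  | tmul f g =>
    rw [LinearMap.lTensor_tmul]
    exact (pairing₃_tmul f _ a b c).trans (congrArg _ (pairing_comul g b c))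

lemma pairing₃_assoc_tmul [Module.Finite k H] (y : HopfDual k H ⊗[k] HopfDual k H)
    (g : Module.Dual k H) (a b c : H) :
    pairing₃ k H (TensorProduct.assoc k _ _ _ (y ⊗ₜ[k] g))
      (a ⊗ₜ[k] (b ⊗ₜ[k] c)) = pairing k H y (a ⊗ₜ[k] b) * g c := by
  induction y with
  | zero => simp
  | add x y hx hy =>
    simp only [TensorProduct.add_tmul, map_add, LinearMap.add_apply, hx, hy, add_mul]
  | tmul e f => exact (mul_assoc _ _ _).symm

lemma pairing₃_rTensor [Module.Finite k H] (x : HopfDual k H ⊗[k] HopfDual k H) (a b c : H) :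
    pairing₃ k H (TensorProduct.assoc k _ _ _ (Coalgebra.comul.rTensor (HopfDual k H) x))
      (a ⊗ₜ[k] (b ⊗ₜ[k] c)) = pairing k H x ((a * b) ⊗ₜ[k] c) := by
  induction x with
  | zero => simp
  | add x y hx hy => simp only [map_add, LinearMap.add_apply, hx, hy]
  | tmul f g =>
    rw [LinearMap.rTensor_tmul]
    exact (pairing₃_assoc_tmul _ g a b c).trans (congrArg (· * g c) (pairing_comul f a b))

lemma lid_rTensor_counit [Module.Finite k H] (x : HopfDual k H ⊗[k] HopfDual k H) (a : H) :
    TensorProduct.lid k _ (Coalgebra.counit.rTensor (HopfDual k H) x) a =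
      pairing k H x (1 ⊗ₜ[k] a) := by
  induction x with
  | zero => simp
  | add x y hx hy => simp only [map_add, LinearMap.add_apply, hx, hy]
  | tmul f g => rfl

lemma rid_lTensor_counit [Module.Finite k H] (x : HopfDual k H ⊗[k] HopfDual k H) (a : H) :
    TensorProduct.rid k _ (Coalgebra.counit.lTensor (HopfDual k H) x) a =
      pairing k H x (a ⊗ₜ[k] 1) := by
  induction x with
  | zero => simp
  | add x y hx hy => simp only [map_add, LinearMap.add_apply, hx, hy]
  | tmul f g => exact mul_comm _ _

/-- The dual of a finite-dimensional algebra is a coalgebra. -/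
instance [Module.Finite k H] : Coalgebra k (HopfDual k H) where
  coassoc := by
    refine LinearMap.ext fun f => (pairing₃ k H).injective ?_
    refine TensorProduct.ext' fun a x => ?_
    induction x with
    | zero => simp
    | add x y hx hy => simp only [TensorProduct.tmul_add, map_add, hx, hy]
    | tmul b c =>
      exact (pairing₃_rTensor _ a b c).trans <| (pairing_comul f _ _).trans <|
        (congrArg _ (mul_assoc a b c)).trans <| (pairing_comul f _ _).symm.trans
          (pairing₃_lTensor _ a b c).symm
  rTensor_counit_comp_comul := by
    refine LinearMap.ext fun f => (TensorProduct.lid k (HopfDual k H)).injective ?_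
    refine LinearMap.ext fun a => ?_
    refine (lid_rTensor_counit _ a).trans ((pairing_comul f 1 a).trans ?_)
    simp only [one_mul, TensorProduct.mk_apply, TensorProduct.lid_tmul, one_smul]
  lTensor_counit_comp_comul := by
    refine LinearMap.ext fun f => (TensorProduct.rid k (HopfDual k H)).injective ?_
    refine LinearMap.ext fun a => ?_
    refine (rid_lTensor_counit _ a).trans ((pairing_comul f a 1).trans ?_)
    simp only [mul_one, LinearMap.flip_apply, TensorProduct.mk_apply, TensorProduct.rid_tmul,
      one_smul]

end HopfDual

/-! ### Dual and tensor product of modules over a Hopf algebra -/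

/-- The dual `V* = Hom(V, k)` of a module `V` over a Hopf algebra `H`, with the action
`(h • f) v = f (S h • v)`. -/
def HopfDualModule (k : Type u) (H : Type v) (V : Type w) [Field k] [Ring H] [HopfAlgebra k H]
    [AddCommGroup V] [Module k V] [Module H V] [IsScalarTower k H V] : Type (max u w) :=
  Module.Dual k V

namespace HopfDualModule

variable {k : Type u} {H : Type v} {V : Type w} [Field k] [Ring H] [HopfAlgebra k H]
  [AddCommGroup V] [Module k V] [Module H V] [IsScalarTower k H V]

instance : AddCommGroup (HopfDualModule k H V) :=
  inferInstanceAs (AddCommGroup (Module.Dual k V))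

instance : Module k (HopfDualModule k H V) := inferInstanceAs (Module k (Module.Dual k V))

variable (k H V) in
/-- The action of `H` on `V*`, as an algebra homomorphism `H → End(V*)`. -/
def actionHom : H →ₐ[k] Module.End k (Module.Dual k V) :=
  AlgHom.ofLinearMap
    ((Module.Dual.transpose (R := k) (M := V) (M' := V)) ∘ₗ
      (Algebra.lsmul k k V).toLinearMap ∘ₗ HopfAlgebra.antipode k (A := H))
    (by
      ext f x
      simp [Module.Dual.transpose_apply])
    (by
      intro a b
      ext f x
      simp [HopfAlgebra.antipode_mul_antidistrib, Module.Dual.transpose_apply])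

instance : Module H (HopfDualModule k H V) :=
  Module.compHom (Module.Dual k V) (actionHom k H V).toRingHom

lemma smul_apply (h : H) (f : HopfDualModule k H V) (x : V) :
    (show Module.Dual k V from h • f) x =
      (show Module.Dual k V from f) (HopfAlgebra.antipode k h • x) := rfl

instance : IsScalarTower k H (HopfDualModule k H V) where
  smul_assoc c h f := LinearMap.congr_fun (map_smul (actionHom k H V) c h) f

end HopfDualModule

/-- The tensor product `V ⊗ W` over `k` of two modules over a Hopf algebra `H`, with the
diagonal action `h • (x ⊗ y) = ∑ (h₁ • x) ⊗ (h₂ • y)`, where `Δ h = ∑ h₁ ⊗ h₂`. -/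
def HopfTensor (k : Type u) (H : Type v) (V : Type w) (W : Type w') [Field k] [Ring H] [HopfAlgebra k H]
    [AddCommGroup V] [Module k V] [Module H V] [IsScalarTower k H V]
    [AddCommGroup W] [Module k W] [Module H W] [IsScalarTower k H W] :
    Type (max w w') :=
  V ⊗[k] W

namespace HopfTensor

variable {k : Type u} {H : Type v} {V : Type w} {W : Type w'} [Field k] [Ring H] [HopfAlgebra k H]
  [AddCommGroup V] [Module k V] [Module H V] [IsScalarTower k H V]
  [AddCommGroup W] [Module k W] [Module H W] [IsScalarTower k H W]

instance : AddCommGroup (HopfTensor k H V W) := inferInstanceAs (AddCommGroup (V ⊗[k] W))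

instance : Module k (HopfTensor k H V W) := inferInstanceAs (Module k (V ⊗[k] W))

variable (k H V W) in
/-- The action of `H` on `V ⊗ W`: comultiply, then act on each of the two factors. -/
def actionHom : H →ₐ[k] Module.End k (V ⊗[k] W) :=
  (Module.endTensorEndAlgHom (R := k) (S := k) (A := k) (M := V) (N := W)).comp
    ((Algebra.TensorProduct.map (Algebra.lsmul k k V) (Algebra.lsmul k k W)).comp
      (Bialgebra.comulAlgHom k H))

instance : Module H (HopfTensor k H V W) :=
  Module.compHom (V ⊗[k] W) (actionHom k H V W).toRingHom


instance : IsScalarTower k H (HopfTensor k H V W) where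
  smul_assoc c h t := LinearMap.congr_fun (map_smul (actionHom k H V W) c h) t

end HopfTensor

/-! ### Inner-faithful modules and direct summands -/

/-- A module `V` over a Hopf algebra `H` is inner-faithful if the only Hopf ideal of `H`
(two-sided ideal that is a coideal stable under the antipode) annihilating `V` is zero. -/
def IsInnerFaithful (k : Type u) (H : Type v) (V : Type w) [Field k] [Ring H] [HopfAlgebra k H]
    [AddCommGroup V] [Module H V] : Prop :=
  ∀ I : Ideal H, I.IsTwoSided → I.IsHopfIdeal k → (∀ h ∈ I, ∀ x : V, h • x = 0) → I = ⊥

/-- The `H`-module `M` is isomorphic to a direct summand of the `H`-module `V`. -/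
def IsDirectSummandOf (H : Type u) (M : Type v) (V : Type w) [Ring H] [AddCommGroup M]
    [Module H M] [AddCommGroup V] [Module H V] : Prop :=
  ∃ A B : Submodule H V, IsCompl A B ∧ Nonempty (M ≃ₗ[H] A)

end

/-! Eight characters and irreducible two-dimensional representations must fit into dimension 16, and
8 + 2·4 = 16, so there are at most two classes of the latter; once two inequivalent ones are known,
they and the characters are jointly faithful (`exists_intertwiner_of_three`, `eq_zero_of_forall`).

Let ρ be the matrix form of π and let S be the group of characters g with g ⊗ ρ ≅ ρ, equivalently
those occurring in ρ ⊗ ρ*. Their weight vectors are independent in the four-dimensional matrix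
space, so |S| ≤ 4; as g ⊗ ρ takes at most two classes, |S| ≥ 4 (`card_isStab`). Thus S has index two
and ρ ⊗ ρ* is the sum of the characters in S.

If ρ is not self-dual, then ρ and ρ* are inequivalent, and a character outside S interchanges them,
hence occurs in ρ ⊗ ρ. A Hopf ideal killing ρ therefore kills every character as well as ρ*, and is
zero (`eq_bot_of_not_isTensorWeight_one`).

If ρ is self-dual, then ρ ⊗ ρ and ρ ⊗ ρ* have the same weights, and the coefficients of ρ together
with S span a space closed under convolution and antipode. Its annihilator is a Hopf ideal
(`isHopfIdeal_stabIdeal`), nonzero because that space has dimension at most 8. It kills ρ and each φ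
in S. For φ outside S, a Hopf ideal killing ρ ⊕ φ kills S, the other coset φS and the second class φ
⊗ ρ, so it is zero (`eq_bot_of_not_isStab`). -/

noncomputable section

set_option linter.unusedSectionVars false

open Coalgebra WithConv Matrix

/-! ### The convolution ring of matrix-valued functions on a Hopf algebra -/

namespace ConvMatrix

variable {k : Type*} {H : Type*} {n : Type*} [Field k] [Ring H] [HopfAlgebra k H]
  [Fintype n] [DecidableEq n]

variable (k H n) in
/-- The convolution ring of linear maps from `H` to matrices. -/
abbrev ConvRing : Type _ := WithConv (H →ₗ[k] Matrix n n k)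

variable (k H) in
/-- The constant function with value `X`, that is `h ↦ ε(h) X`. -/
def const (X : Matrix n n k) : ConvRing k H n := toConv ((counit (R := k) (A := H)).smulRight X)

/-- The scalar matrix-valued function attached to a character. -/
def char (n : Type*) [Fintype n] [DecidableEq n] (g : WithConv (H →ₐ[k] k)) : ConvRing k H n :=
  toConv (g.ofConv.toLinearMap.smulRight 1)

/-- A representation as an element of the convolution ring. -/
def rep (ρ : H →ₐ[k] Matrix n n k) : ConvRing k H n := toConv ρ.toLinearMap

/-- The convolution inverse of a representation. -/
def repInv (ρ : H →ₐ[k] Matrix n n k) : ConvRing k H n :=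
  toConv (ρ.toLinearMap ∘ₗ HopfAlgebra.antipode k)

/-- Pointwise transposition. -/
def tr (f : ConvRing k H n) : ConvRing k H n :=
  toConv ((Matrix.transposeLinearEquiv n n k k).toLinearMap ∘ₗ f.ofConv)

@[simp] lemma const_apply (X : Matrix n n k) (h : H) :
    const k H X h = counit (R := k) h • X := rfl

@[simp] lemma char_apply (g : WithConv (H →ₐ[k] k)) (h : H) :
    char n g h = g h • (1 : Matrix n n k) := rfl

@[simp] lemma rep_apply (ρ : H →ₐ[k] Matrix n n k) (h : H) : rep ρ h = ρ h := rfl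

@[simp] lemma repInv_apply (ρ : H →ₐ[k] Matrix n n k) (h : H) :
    repInv ρ h = ρ (HopfAlgebra.antipode k h) := rfl

@[simp] lemma tr_apply (f : ConvRing k H n) (h : H) : tr f h = (f h)ᵀ := rfl

lemma ext {f g : ConvRing k H n} (h : ∀ x, f x = g x) : f = g :=
  WithConv.ext (LinearMap.ext h)

-- By the counit axiom, constants act by pointwise multiplication. Equations between representations
-- thus become identities in one associative ring.
@[simp] lemma const_mul_apply (X : Matrix n n k) (f : ConvRing k H n) (h : H) :
    (const k H X * f) h = X * f h := by
  let r := Coalgebra.Repr.arbitrary k h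
  rw [r.convMul_apply]
  have := congrArg f.ofConv (Coalgebra.sum_counit_smul r)
  rw [← this]
  simp [Finset.mul_sum]

@[simp] lemma mul_const_apply (X : Matrix n n k) (f : ConvRing k H n) (h : H) :
    (f * const k H X) h = f h * X := by
  let r := Coalgebra.Repr.arbitrary k h
  rw [r.convMul_apply]
  have := congrArg (fun t => f (TensorProduct.rid k H t)) (Coalgebra.sum_tmul_counit_eq r)
  simp only [map_sum, TensorProduct.rid_tmul, one_smul] at this
  rw [← this]
  simp [Finset.sum_mul]

lemma const_mul_const (X Y : Matrix n n k) : const k H X * const k H Y = const k H (X * Y) :=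
  ext fun h => by simp [-LinearMap.convMul_apply]

lemma const_one : const k H (1 : Matrix n n k) = 1 :=
  ext fun h => by simp [Algebra.algebraMap_eq_smul_one]

lemma char_mul_const_apply (g : WithConv (H →ₐ[k] k)) (X : Matrix n n k) (h : H) :
    (char n g * const k H X) h = g h • X := by simp [-LinearMap.convMul_apply]

lemma char_mul_const (g : WithConv (H →ₐ[k] k)) (X : Matrix n n k) :
    char n g * const k H X = const k H X * char n g := ext fun h => by simp [-LinearMap.convMul_apply]

lemma char_mul (g g' : WithConv (H →ₐ[k] k)) : char n (g * g') = char n g * char n g' := by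
  refine ext fun h => ?_
  let r := Coalgebra.Repr.arbitrary k h
  rw [r.convMul_apply, char_apply]
  have : (g * g') h = ∑ i ∈ r.index, g (r.left i) * g' (r.right i) := by
    rw [AlgHom.convMul_apply, ← r.eq]; simp
  simp [this, Finset.sum_smul, smul_smul, mul_comm]

lemma char_one : char n (1 : WithConv (H →ₐ[k] k)) = 1 :=
  ext fun h => by simp [Algebra.algebraMap_eq_smul_one]

/-- The inverse `g ∘ S` of a character for the convolution product. -/
def charInv (g : H →ₐ[k] k) : H →ₐ[k] k :=
  AlgHom.ofLinearMap (g.toLinearMap ∘ₗ HopfAlgebra.antipode k) (by simp)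
    (fun x y => by simp [HopfAlgebra.antipode_mul_antidistrib, mul_comm])

lemma charInv_apply (g : H →ₐ[k] k) (h : H) :
    charInv g h = g (HopfAlgebra.antipode k h) := rfl

instance : Group (WithConv (H →ₐ[k] k)) where
  inv g := toConv (charInv g.ofConv)
  inv_mul_cancel g := by
    refine WithConv.ext (AlgHom.ext fun h => ?_)
    let r := Coalgebra.Repr.arbitrary k h
    have := congrArg g.ofConv (HopfAlgebra.sum_antipode_mul_eq_algebraMap_counit r)
    rw [map_sum] at this
    rw [AlgHom.convMul_apply, ← r.eq]
    simpa [charInv_apply] using this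

lemma char_mul_char_inv (g : WithConv (H →ₐ[k] k)) : char n g * char n g⁻¹ = 1 := by
  rw [← char_mul, mul_inv_cancel, char_one]

lemma char_inv_mul_char (g : WithConv (H →ₐ[k] k)) : char n g⁻¹ * char n g = 1 := by
  rw [← char_mul, inv_mul_cancel, char_one]

lemma rep_mul_repInv (ρ : H →ₐ[k] Matrix n n k) : rep ρ * repInv ρ = 1 := by
  refine ext fun h => ?_
  let r := Coalgebra.Repr.arbitrary k h
  rw [r.convMul_apply]
  have := congrArg ρ (HopfAlgebra.sum_mul_antipode_eq_algebraMap_counit r)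
  simpa using this

lemma repInv_mul_rep (ρ : H →ₐ[k] Matrix n n k) : repInv ρ * rep ρ = 1 := by
  refine ext fun h => ?_
  let r := Coalgebra.Repr.arbitrary k h
  rw [r.convMul_apply]
  have := congrArg ρ (HopfAlgebra.sum_antipode_mul_eq_algebraMap_counit r)
  simpa using this

lemma tr_const_mul (X : Matrix n n k) (f : ConvRing k H n) :
    tr (const k H X * f) = tr f * const k H Xᵀ := ext fun h => by simp [-LinearMap.convMul_apply]

lemma tr_mul_const (X : Matrix n n k) (f : ConvRing k H n) :
    tr (f * const k H X) = const k H Xᵀ * tr f := ext fun h => by simp [-LinearMap.convMul_apply]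

lemma tr_tr (f : ConvRing k H n) : tr (tr f) = f := ext fun h => by simp [-LinearMap.convMul_apply]

/-- Transposition does not reverse convolution, since the coproduct legs keep their order; the
scalar factor therefore stays on the right. -/
lemma tr_mul_char (f : ConvRing k H n) (g : WithConv (H →ₐ[k] k)) :
    tr (f * char n g) = tr f * char n g := by
  refine ext fun h => ?_
  let r := Coalgebra.Repr.arbitrary k h
  rw [tr_apply, r.convMul_apply, r.convMul_apply]
  simp [Matrix.transpose_sum]

/-! ### Twists and duals of representations -/

/-- The representation `g ⊗ ρ`. -/
def twistLeft (g : WithConv (H →ₐ[k] k)) (ρ : H →ₐ[k] Matrix n n k) : H →ₐ[k] Matrix n n k :=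
  (Algebra.TensorProduct.lift ((Algebra.ofId k _).comp g.ofConv) ρ
    fun x y => by
      rw [AlgHom.comp_apply, Algebra.ofId_apply]
      exact Algebra.commutes (g x) (ρ y)).comp (Bialgebra.comulAlgHom k H)

/-- The representation `ρ ⊗ g`. -/
def twistRight (ρ : H →ₐ[k] Matrix n n k) (g : WithConv (H →ₐ[k] k)) : H →ₐ[k] Matrix n n k :=
  (Algebra.TensorProduct.lift ρ ((Algebra.ofId k _).comp g.ofConv)
    fun x y => by
      rw [AlgHom.comp_apply, Algebra.ofId_apply]
      exact (Algebra.commutes (g y) (ρ x)).symm).comp (Bialgebra.comulAlgHom k H)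

/-- The dual representation `h ↦ ρ(S h)ᵀ`. -/
def dual (ρ : H →ₐ[k] Matrix n n k) : H →ₐ[k] Matrix n n k :=
  AlgHom.ofLinearMap (tr (repInv ρ)).ofConv
    (by change (ρ (HopfAlgebra.antipode k 1))ᵀ = 1; simp)
    (fun x y => by
      change (ρ (HopfAlgebra.antipode k (x * y)))ᵀ = (ρ (HopfAlgebra.antipode k x))ᵀ *
        (ρ (HopfAlgebra.antipode k y))ᵀ
      simp [HopfAlgebra.antipode_mul_antidistrib])

lemma rep_dual (ρ : H →ₐ[k] Matrix n n k) : rep (dual ρ) = tr (repInv ρ) := rfl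

lemma dual_apply (ρ : H →ₐ[k] Matrix n n k) (h : H) :
    dual ρ h = (ρ (HopfAlgebra.antipode k h))ᵀ := rfl

lemma rep_twistLeft (g : WithConv (H →ₐ[k] k)) (ρ : H →ₐ[k] Matrix n n k) :
    rep (twistLeft g ρ) = char n g * rep ρ := by
  refine ext fun h => ?_
  let r := Coalgebra.Repr.arbitrary k h
  rw [r.convMul_apply, rep_apply, twistLeft, AlgHom.comp_apply, Bialgebra.comulAlgHom_apply,
    ← r.eq, map_sum]
  refine Finset.sum_congr rfl fun i _ => ?_
  rw [Algebra.TensorProduct.lift_tmul]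
  simp [Algebra.ofId_apply, Algebra.algebraMap_eq_smul_one]

lemma rep_twistRight (g : WithConv (H →ₐ[k] k)) (ρ : H →ₐ[k] Matrix n n k) :
    rep (twistRight ρ g) = rep ρ * char n g := by
  refine ext fun h => ?_
  let r := Coalgebra.Repr.arbitrary k h
  rw [r.convMul_apply, rep_apply, twistRight, AlgHom.comp_apply, Bialgebra.comulAlgHom_apply,
    ← r.eq, map_sum]
  refine Finset.sum_congr rfl fun i _ => ?_
  rw [Algebra.TensorProduct.lift_tmul]
  simp [Algebra.ofId_apply, Algebra.algebraMap_eq_smul_one]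

/-- Both factors descend to H/I, and the coideal condition says that the coproduct of an element of
I dies in H/I ⊗ H/I. -/
lemma mul_vanishes {I : Ideal H} (hI : I.IsHopfIdeal k) {f g : ConvRing k H n}
    (hf : ∀ h ∈ I, f h = 0) (hg : ∀ h ∈ I, g h = 0) : ∀ h ∈ I, (f * g) h = 0 := by
  intro h hh
  have key := hI.map_mkQ_comul_eq_zero (x := h) hh
  let f' := (I.restrictScalars k).liftQ f.ofConv (fun x hx => hf x hx)
  let g' := (I.restrictScalars k).liftQ g.ofConv (fun x hx => hg x hx)
  have e : TensorProduct.map f.ofConv g.ofConv = TensorProduct.map f' g' ∘ₗ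
      TensorProduct.map (I.restrictScalars k).mkQ (I.restrictScalars k).mkQ := by
    rw [← TensorProduct.map_comp]
    rfl
  rw [LinearMap.convMul_apply, e, LinearMap.comp_apply, key, map_zero, map_zero]

lemma const_vanishes {I : Ideal H} (hI : I.IsHopfIdeal k) (X : Matrix n n k) :
    ∀ h ∈ I, const k H X h = 0 := fun h hh => by
  rw [const_apply, hI.counit_eq_zero hh, zero_smul]

end ConvMatrix

/-! ### Surjective matrix representations of an algebra -/

section Separation

variable {H A B : Type*} [Ring H] [Ring A] [Ring B]

/-- The image of ker g under the surjection f is an ideal of a simple ring: either it contains 1, or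
it is zero and f kills ker g. -/
lemma exists_eq_one_of_not_ker_le [IsSimpleRing A] (f : H →+* A) (g : H →+* B)
    (hf : Function.Surjective f) (h : ¬ ∀ x, g x = 0 → f x = 0) : ∃ e, f e = 1 ∧ g e = 0 := by
  have : RingHomSurjective f := ⟨hf⟩
  by_cases htop : (RingHom.ker g).map f = ⊤
  · have h1 : (1 : A) ∈ (RingHom.ker g).map f := htop ▸ Submodule.mem_top
    obtain ⟨e, he, he1⟩ := (Ideal.mem_map_iff_of_surjective f hf).1 h1
    exact ⟨e, he1, he⟩
  · have : Nontrivial (A ⧸ (RingHom.ker g).map f) := Ideal.Quotient.nontrivial_iff.2 htop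
    refine absurd (fun x hx => ?_) h
    refine (Ideal.Quotient.mk ((RingHom.ker g).map f)).injective ?_
    rw [map_zero, Ideal.Quotient.eq_zero_iff_mem]
    exact Ideal.mem_map_of_mem f hx

lemma exists_eq_one_of_ker_ne [IsSimpleRing A] [IsSimpleRing B] (f : H →+* A) (g : H →+* B)
    (hf : Function.Surjective f) (hg : Function.Surjective g)
    (h : RingHom.ker f ≠ RingHom.ker g) : ∃ e, f e = 1 ∧ g e = 0 := by
  by_cases h1 : ∀ x, g x = 0 → f x = 0
  · by_cases h2 : ∀ x, f x = 0 → g x = 0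
    · exact absurd (le_antisymm h2 h1) h
    · obtain ⟨e, he, he'⟩ := exists_eq_one_of_not_ker_le g f hg h2
      exact ⟨1 - e, by simp [he'], by simp [he]⟩
  · exact exists_eq_one_of_not_ker_le f g hf h1

/-- Pairwise comaximal two-sided ideals are separated by the elements of the ring. -/
lemma exists_forall_mem_of_pairwise {ι : Type*} (I : ι → Ideal H) [∀ i, (I i).IsTwoSided]
    (hI : ∀ i j, i ≠ j → ∃ e, 1 - e ∈ I i ∧ e ∈ I j) (i : ι) (s : Finset ι) (hi : i ∉ s) :
    ∃ e, 1 - e ∈ I i ∧ ∀ j ∈ s, e ∈ I j := by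
  classical
  induction s using Finset.induction_on with
  | empty => exact ⟨1, by simp, by simp⟩
  | insert j s _ ih =>
    obtain ⟨e, he, hes⟩ := ih fun h => hi (Finset.mem_insert_of_mem h)
    obtain ⟨e', he', hej⟩ := hI i j fun h => hi (h ▸ Finset.mem_insert_self _ _)
    refine ⟨e * e', ?_, fun l hl => ?_⟩
    · have : 1 - e * e' = (1 - e') + (1 - e) * e' := by noncomm_ring
      rw [this]
      exact add_mem he' (Ideal.mul_mem_right _ _ he)
    · rcases Finset.mem_insert.1 hl with rfl | hl
      · exact Ideal.mul_mem_left _ _ hej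
      · exact Ideal.mul_mem_right _ _ (hes l hl)

end Separation

section Characters

variable {k : Type*} {H : Type*} {m : Type*} [Field k] [Ring H] [Algebra k H] [Fintype m]
  [DecidableEq m]

lemma AlgHom.surjective_of_field (g : H →ₐ[k] k) : Function.Surjective g := fun c =>
  ⟨algebraMap k H c, by simp⟩

lemma AlgHom.eq_of_ker_eq {g g' : H →ₐ[k] k}
    (h : RingHom.ker (g : H →+* k) = RingHom.ker (g' : H →+* k)) : g = g' := by
  refine AlgHom.ext fun x => ?_
  have h1 : x - algebraMap k H (g x) ∈ RingHom.ker (g : H →+* k) := by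
    simp [RingHom.mem_ker]
  rw [h] at h1
  have h2 : g' x - g x = 0 := by simpa [RingHom.mem_ker] using h1
  exact (sub_eq_zero.1 h2).symm

/-- If ker g lay in ker ρ, every ρ(x) would be the scalar g(x), contradicting that an off-diagonal
matrix unit is attained. -/
lemma exists_eq_one_character_eq_zero [Nontrivial m] {ρ : H →ₐ[k] Matrix m m k}
    (hρ : Function.Surjective ρ) (g : H →ₐ[k] k) : ∃ e, ρ e = 1 ∧ g e = 0 := by
  refine exists_eq_one_of_not_ker_le (ρ : H →+* Matrix m m k) (g : H →+* k) hρ fun h => ?_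
  obtain ⟨a, b, hab⟩ := exists_pair_ne m
  obtain ⟨x, hx⟩ := hρ (Matrix.single a b 1)
  have h1 := h (x - algebraMap k H (g x)) (by simp)
  have h2 : ρ x = algebraMap k _ (g x) := by simpa [sub_eq_zero] using h1
  have h3 := congrFun (congrFun (hx.symm.trans h2) a) b
  rw [Matrix.algebraMap_matrix_apply, if_neg hab] at h3
  simp at h3

/-- Distinct characters and matrix representations with distinct kernels are jointly surjective. -/
lemma surjective_pi_prod_pi [Nontrivial m] [Finite (H →ₐ[k] k)] {r : Type*} [Finite r]
    (ρ : r → H →ₐ[k] Matrix m m k) (hρ : ∀ i, Function.Surjective (ρ i))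
    (hker : ∀ i j, i ≠ j → RingHom.ker (ρ i : H →+* Matrix m m k) ≠
      RingHom.ker (ρ j : H →+* Matrix m m k)) :
    Function.Surjective
      (fun h => ((fun g => g h, fun i => ρ i h) : ((H →ₐ[k] k) → k) × (r → Matrix m m k))) := by
  classical
  have := Fintype.ofFinite r
  have := Fintype.ofFinite (H →ₐ[k] k)
  let I : (H →ₐ[k] k) ⊕ r → Ideal H :=
    Sum.elim (fun g => RingHom.ker (g : H →+* k)) (fun i => RingHom.ker (ρ i : H →+* Matrix m m k))
  have : ∀ i, (I i).IsTwoSided := by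
    rintro (g | i)
    · exact inferInstanceAs (RingHom.ker (g : H →+* k)).IsTwoSided
    · exact inferInstanceAs (RingHom.ker (ρ i : H →+* Matrix m m k)).IsTwoSided
  have hI : ∀ i j, i ≠ j → ∃ e, 1 - e ∈ I i ∧ e ∈ I j := by
    rintro (g | i) (g' | j) hij
    · obtain ⟨e, h1, h2⟩ := exists_eq_one_of_ker_ne (g : H →+* k) (g' : H →+* k)
        g.surjective_of_field g'.surjective_of_field
        (fun h => hij (congrArg _ (AlgHom.eq_of_ker_eq h)))
      refine ⟨e, ?_, h2⟩
      change (g : H →+* k) (1 - e) = 0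
      rw [map_sub, map_one, h1, sub_self]
    · obtain ⟨e, h1, h2⟩ := exists_eq_one_character_eq_zero (hρ j) g
      refine ⟨1 - e, ?_, ?_⟩
      · change g (1 - (1 - e)) = 0
        simp [h2]
      · change ρ j (1 - e) = 0
        simp [h1]
    · obtain ⟨e, h1, h2⟩ := exists_eq_one_character_eq_zero (hρ i) g'
      refine ⟨e, ?_, h2⟩
      change ρ i (1 - e) = 0
      simp [h1]
    · obtain ⟨e, h1, h2⟩ := exists_eq_one_of_ker_ne (ρ i : H →+* Matrix m m k)
        (ρ j : H →+* Matrix m m k) (hρ i) (hρ j) (hker i j fun h => hij (congrArg _ h))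
      refine ⟨e, ?_, h2⟩
      change (ρ i : H →+* Matrix m m k) (1 - e) = 0
      rw [map_sub, map_one, h1, sub_self]
  -- Chinese remainder theorem: `e i` maps to 1 in the i-th factor and to 0 in all others.
  choose e he1 he0 using fun i => exists_forall_mem_of_pairwise I hI i (Finset.univ.erase i)
    (Finset.notMem_erase _ _)
  replace he0 : ∀ i j, i ≠ j → e i ∈ I j := fun i j hij =>
    he0 i j (Finset.mem_erase.2 ⟨hij.symm, Finset.mem_univ _⟩)
  have hgg : ∀ g : H →ₐ[k] k, g (e (.inl g)) = 1 := fun g => by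
    have : g (1 - e (.inl g)) = 0 := he1 (.inl g)
    rw [map_sub, map_one, sub_eq_zero] at this
    exact this.symm
  have hρρ : ∀ i, ρ i (e (.inr i)) = 1 := fun i => by
    have : ρ i (1 - e (.inr i)) = 0 := he1 (.inr i)
    rw [map_sub, map_one, sub_eq_zero] at this
    exact this.symm
  have hg0 : ∀ (g : H →ₐ[k] k) i, i ≠ .inl g → g (e i) = 0 := fun g i hi => he0 i (.inl g) hi
  have hρ0 : ∀ j i, i ≠ .inr j → ρ j (e i) = 0 := fun j i hi => he0 i (.inr j) hi
  rintro ⟨a, b⟩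
  choose b' hb' using fun i => hρ i (b i)
  refine ⟨∑ g, e (.inl g) * algebraMap k H (a g) + ∑ i, e (.inr i) * b' i, Prod.ext ?_ ?_⟩
  · funext g
    simp only [map_add, map_sum, map_mul]
    rw [Finset.sum_eq_single g, Finset.sum_eq_zero, hgg]
    · simp
    · intro i _
      rw [hg0 g _ (by simp), zero_mul]
    · intro g' _ hg'
      rw [hg0 g _ (by simpa using hg'), zero_mul]
    · simp
  · funext j
    simp only [map_add, map_sum, map_mul]
    rw [Finset.sum_eq_zero, Finset.sum_eq_single j, hρρ, hb', one_mul, zero_add]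
    · intro i _ hi
      rw [hρ0 j _ (by simpa using hi), zero_mul]
    · simp
    · intro g _
      rw [hρ0 j _ (by simp), zero_mul]

variable [FiniteDimensional k H]

lemma card_add_card_mul_le [Nontrivial m] [Finite (H →ₐ[k] k)] {r : Type*} [Finite r]
    (ρ : r → H →ₐ[k] Matrix m m k) (hρ : ∀ i, Function.Surjective (ρ i))
    (hker : ∀ i j, i ≠ j → RingHom.ker (ρ i : H →+* Matrix m m k) ≠
      RingHom.ker (ρ j : H →+* Matrix m m k)) :
    Nat.card (H →ₐ[k] k) + Nat.card r * (Nat.card m * Nat.card m) ≤ Module.finrank k H ∧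
    (Nat.card (H →ₐ[k] k) + Nat.card r * (Nat.card m * Nat.card m) = Module.finrank k H →
      ∀ h, (∀ g : H →ₐ[k] k, g h = 0) → (∀ i, ρ i h = 0) → h = 0) := by
  classical
  have := Fintype.ofFinite r
  have := Fintype.ofFinite (H →ₐ[k] k)
  let Φ : H →ₗ[k] ((H →ₐ[k] k) → k) × (r → Matrix m m k) :=
    (LinearMap.pi fun g => g.toLinearMap).prod (LinearMap.pi fun i => (ρ i).toLinearMap)
  have hΦ : Function.Surjective Φ := surjective_pi_prod_pi ρ hρ hker
  have hdim : Module.finrank k (((H →ₐ[k] k) → k) × (r → Matrix m m k)) =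
      Nat.card (H →ₐ[k] k) + Nat.card r * (Nat.card m * Nat.card m) := by
    simp [Module.finrank_prod, Module.finrank_pi_fintype, Module.finrank_matrix,
      Nat.card_eq_fintype_card]
  refine ⟨hdim ▸ LinearMap.finrank_le_finrank_of_surjective hΦ, fun heq h hg hi => ?_⟩
  refine (LinearMap.injective_iff_surjective_of_finrank_eq_finrank (heq ▸ hdim.symm)).2 hΦ ?_
  rw [map_zero]
  exact Prod.ext (funext hg) (funext hi)

end Characters

/-! ### Equivalence of matrix representations and Schur's lemma -/

section Intertwiners

variable {k : Type*} {H : Type*} {m : Type*} [Field k] [Ring H] [Algebra k H] [Fintype m]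
  [DecidableEq m] {σ τ : H →ₐ[k] Matrix m m k}

/-- Surjective representations with the same kernel are equivalent. -/
lemma exists_intertwiner_of_ker_eq (hσ : Function.Surjective σ) (hτ : Function.Surjective τ)
    (h : RingHom.ker (σ : H →+* Matrix m m k) = RingHom.ker (τ : H →+* Matrix m m k)) :
    ∃ X : Matrix m m k, IsUnit X ∧ ∀ x, σ x * X = X * τ x := by
  let e : Matrix m m k ≃ₐ[k] Matrix m m k :=
    (Ideal.quotientKerAlgEquivOfSurjective hτ).symm.trans
      ((Ideal.quotientEquivAlgOfEq k h.symm).trans (Ideal.quotientKerAlgEquivOfSurjective hσ))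
  have he : ∀ x, e (τ x) = σ x := by
    intro x
    have : (Ideal.quotientKerAlgEquivOfSurjective hτ).symm (τ x) = Ideal.Quotient.mk _ x := by
      rw [AlgEquiv.symm_apply_eq]
      rfl
    change Ideal.quotientKerAlgEquivOfSurjective hσ (Ideal.quotientEquivAlgOfEq k h.symm
      ((Ideal.quotientKerAlgEquivOfSurjective hτ).symm (τ x))) = σ x
    rw [this]
    rfl
  let E := Matrix.toLinAlgEquiv' (R := k) (n := m)
  obtain ⟨T, hT⟩ := ((E.symm.trans e).trans E).eq_linearEquivConjAlgEquiv
  refine ⟨E.symm T.toLinearMap, ?_, fun x => ?_⟩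
  · refine IsUnit.map E.symm ?_
    exact (Module.End.isUnit_iff _).2 T.bijective
  · have h1 := congrArg (fun f => f (E (τ x))) hT
    simp only [AlgEquiv.trans_apply, AlgEquiv.symm_apply_apply, he] at h1
    apply E.injective
    rw [map_mul, map_mul, AlgEquiv.apply_symm_apply, h1]
    ext v
    simp [LinearEquiv.conjAlgEquiv_apply]

/-- A nonzero intertwiner between surjective representations is invertible. -/
lemma isUnit_of_intertwiner (hτ : Function.Surjective τ)
    {X : Matrix m m k} (hX : X ≠ 0) (h : ∀ x, σ x * X = X * τ x) : IsUnit X := by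
  rw [Matrix.isUnit_iff_isUnit_det, isUnit_iff_ne_zero]
  intro hdet
  obtain ⟨v, hv, hXv⟩ := Matrix.exists_mulVec_eq_zero_iff.2 hdet
  apply hX
  obtain ⟨j, hj⟩ : ∃ j, v j ≠ 0 := by
    by_contra! hc
    exact hv (funext hc)
  ext a b
  -- This matrix unit sends the kernel vector v to v_j times the b-th basis vector, so column b of X
  -- vanishes.
  obtain ⟨x, hx⟩ := hτ (Matrix.single b j 1)
  have h1 : (X * τ x).mulVec v = 0 := by
    rw [← h, ← Matrix.mulVec_mulVec, hXv, Matrix.mulVec_zero]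
  rw [hx] at h1
  have h2 := congrFun h1 a
  simp [Matrix.mulVec, dotProduct, Matrix.mul_apply, Matrix.single_apply, Finset.sum_ite_eq,
    ite_and] at h2
  simpa [hj] using h2

end Intertwiners

/-! ### Burnside's theorem and one-dimensional modules -/

section Density

variable {k : Type*} {H : Type*} [Field k] [Ring H] [Algebra k H]

lemma exists_smul_eq_of_isSimpleModule [IsAlgClosed k] {V : Type*} [AddCommGroup V] [Module k V]
    [Module H V] [IsScalarTower k H V] [FiniteDimensional k V] [IsSimpleModule H V]
    (f : V →ₗ[k] V) : ∃ h : H, ∀ x, h • x = f x := by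
  have hb := IsSimpleModule.algebraMap_end_bijective_of_isAlgClosed k (A := H) (V := V)
  -- By Schur's lemma the H-endomorphisms of V are scalars, so f commutes with them and the density
  -- theorem applies to f on a finite spanning set.
  let F : Module.End (Module.End H V) V :=
    { f with
      map_smul' := fun c x => by
        obtain ⟨a, rfl⟩ := hb.2 c
        exact f.map_smul a x }
  obtain ⟨s, hs⟩ := Module.Finite.fg_top (R := k) (M := V)
  obtain ⟨h, hh⟩ := jacobson_density (R := H) F s
  refine ⟨h, fun x => ?_⟩
  have hx : x ∈ Submodule.span k (s : Set V) := hs ▸ Submodule.mem_top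
  induction hx using Submodule.span_induction with
  | mem x hx => exact (hh x hx).symm
  | zero => simp
  | add x y _ _ hx hy => rw [smul_add, hx, hy, map_add]
  | smul c x _ hx => rw [← smul_comm c h x, hx, map_smul]

lemma exists_character_of_finrank_eq_one {V : Type*} [AddCommGroup V] [Module k V]
    [Module H V] [IsScalarTower k H V] (hV : Module.finrank k V = 1) :
    ∃ g : H →ₐ[k] k, ∀ (h : H) (x : V), h • x = g h • x := by
  obtain ⟨v, hv, hspan⟩ := finrank_eq_one_iff'.1 hV
  choose c hc using fun h : H => hspan (h • v)
  have hinj : ∀ a b : k, a • v = b • v → a = b := fun a b hab => smul_left_injective k hv hab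
  let g : H →ₐ[k] k := AlgHom.ofLinearMap
    { toFun := c
      map_add' := fun a b => hinj _ _ (by rw [hc, add_smul, add_smul, hc, hc])
      map_smul' := fun a b => hinj _ _ (by
        rw [hc, smul_assoc, RingHom.id_apply, smul_assoc, hc]) }
    (hinj _ _ (by change c 1 • v = _; rw [hc, one_smul, one_smul]))
    (fun a b => hinj _ _ (by
      change c (a * b) • v = (c a * c b) • v
      rw [hc, mul_smul, ← hc b, smul_comm, ← hc a, smul_smul, mul_comm]))
  refine ⟨g, fun h x => ?_⟩
  obtain ⟨a, rfl⟩ := hspan x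
  change h • a • v = c h • a • v
  rw [smul_comm, ← hc h, smul_comm]

/-- A representation on `k²` without a common eigenvector is surjective. -/
lemma surjective_of_no_common_eigenvector [IsAlgClosed k]
    (ρ : H →ₐ[k] Matrix (Fin 2) (Fin 2) k)
    (hρ : ∀ (g : H →ₐ[k] k) (v : Fin 2 → k), (∀ h, (ρ h).mulVec v = g h • v) → v = 0) :
    Function.Surjective ρ := by
  let _ : Module H (Fin 2 → k) :=
    Module.compHom (Fin 2 → k) ((Matrix.toLinAlgEquiv' (R := k) (n := Fin 2)).toAlgHom.comp
      ρ).toRingHom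
  have hsmul : ∀ (h : H) (v : Fin 2 → k), h • v = (ρ h).mulVec v := fun h v => rfl
  have : IsScalarTower k H (Fin 2 → k) := ⟨fun c h v => by
    rw [hsmul, hsmul, map_smul, Matrix.smul_mulVec]⟩
  have : IsSimpleModule H (Fin 2 → k) := by
    rw [isSimpleModule_iff]
    refine { exists_pair_ne := ⟨⊥, ⊤, bot_ne_top⟩, eq_bot_or_eq_top := fun N => ?_ }
    by_contra! hN
    have : Module.Finite k N := inferInstanceAs (Module.Finite k (N.restrictScalars k))
    have h0 : Module.finrank k N ≠ 0 := fun h => hN.1 <| by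
      have := Module.finrank_zero_iff.1 h
      exact (Submodule.eq_bot_iff _).2 fun x hx =>
        congrArg Subtype.val (Subsingleton.elim (⟨x, hx⟩ : N) 0)
    have h2 : Module.finrank k (N.restrictScalars k) < 2 := by
      have := Submodule.finrank_lt (s := N.restrictScalars k) (fun h => hN.2 <| by
        exact (Submodule.restrictScalars_eq_top_iff k H _).1 h)
      simpa using this
    have h1 : Module.finrank k N = 1 := by
      change Module.finrank k N < 2 at h2
      omega
    obtain ⟨g, hg⟩ := exists_character_of_finrank_eq_one (k := k) (H := H) h1
    refine hN.1 ((Submodule.eq_bot_iff _).2 fun x hx => hρ g x fun h => ?_)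
    exact congrArg Subtype.val (hg h ⟨x, hx⟩)
  intro A
  obtain ⟨h, hh⟩ := exists_smul_eq_of_isSimpleModule (H := H) (Matrix.toLin' A)
  refine ⟨h, Matrix.toLin'.injective (LinearMap.ext fun v => ?_)⟩
  rw [← hh v]
  rfl

end Density

/-! ### Characters as weights of ρ ⊗ ρ* and ρ ⊗ ρ -/

namespace ConvMatrix

section General

variable {k : Type*} {H : Type*} {n : Type*} [Field k] [Ring H] [HopfAlgebra k H]
  [Fintype n] [DecidableEq n]

lemma const_add (X Y : Matrix n n k) : const k H (X + Y) = const k H X + const k H Y :=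
  ext fun h => by simp

lemma const_smul (c : k) (X : Matrix n n k) : const k H (c • X) = c • const k H X :=
  ext fun h => smul_comm (counit (R := k) h) c X

lemma rep_mul_const_eq_iff {σ τ : H →ₐ[k] Matrix n n k} {X : Matrix n n k} :
    rep σ * const k H X = const k H X * rep τ ↔ ∀ h, σ h * X = X * τ h := by
  refine ⟨fun h x => ?_, fun h => ext fun x => by simpa [-LinearMap.convMul_apply] using h x⟩
  simpa [-LinearMap.convMul_apply] using congrArg (fun f : ConvRing k H n => f x) h

lemma const_mul_const_of_mul_eq_one {X Y : Matrix n n k} (h : X * Y = 1) :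
    const k H X * const k H Y = 1 := by rw [const_mul_const, h, const_one]

lemma tr_char (g : WithConv (H →ₐ[k] k)) : tr (char n g) = char n g := ext fun h => by simp

/-- The character `g` is a weight of `ρ ⊗ ρ*`, that is, `g` stabilizes `ρ`. -/
def IsStab (ρ : H →ₐ[k] Matrix n n k) (g : WithConv (H →ₐ[k] k)) : Prop :=
  ∃ X : Matrix n n k, X ≠ 0 ∧ rep ρ * const k H X * repInv ρ = char n g * const k H X

/-- The character `g` is a weight of `ρ ⊗ ρ`. -/
def IsTensorWeight (ρ : H →ₐ[k] Matrix n n k) (g : WithConv (H →ₐ[k] k)) : Prop :=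
  ∃ X : Matrix n n k, X ≠ 0 ∧ rep ρ * const k H X * tr (rep ρ) = char n g * const k H X

/-- Cancelling the invertible `rep ρ` on the right turns a weight vector into an intertwiner between
ρ and g ⊗ ρ. -/
lemma stab_eq_iff {ρ : H →ₐ[k] Matrix n n k} {g : WithConv (H →ₐ[k] k)} {X : Matrix n n k} :
    rep ρ * const k H X * repInv ρ = char n g * const k H X ↔
      rep ρ * const k H X = const k H X * (char n g * rep ρ) := by
  rw [← mul_assoc, ← char_mul_const]
  constructor <;> intro h
  · rw [← h, mul_assoc, repInv_mul_rep, mul_one]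
  · rw [h, mul_assoc, rep_mul_repInv, mul_one]

/-- Cancelling on the left instead gives, after transposition, an intertwiner between ρ* and ρ* ⊗ g.
-/
lemma stab_eq_iff_dual {ρ : H →ₐ[k] Matrix n n k} {g : WithConv (H →ₐ[k] k)} {X : Matrix n n k} :
    rep ρ * const k H X * repInv ρ = char n g * const k H X ↔
      const k H X * repInv ρ = repInv ρ * char n g * const k H X := by
  constructor <;> intro h
  · rw [mul_assoc (repInv ρ), ← h, ← mul_assoc, ← mul_assoc, repInv_mul_rep, one_mul]
  · rw [mul_assoc, h, ← mul_assoc, ← mul_assoc, rep_mul_repInv, one_mul]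

/-- After transposition, the right-hand form is an intertwiner between ρ and ρ* ⊗ g. -/
lemma tensorWeight_eq_iff {ρ : H →ₐ[k] Matrix n n k} {g : WithConv (H →ₐ[k] k)}
    {X : Matrix n n k} :
    rep ρ * const k H X * tr (rep ρ) = char n g * const k H X ↔
      const k H X * tr (rep ρ) = repInv ρ * char n g * const k H X := by
  constructor <;> intro h
  · rw [mul_assoc (repInv ρ), ← h, ← mul_assoc, ← mul_assoc, repInv_mul_rep, one_mul]
  · rw [mul_assoc, h, ← mul_assoc, ← mul_assoc, rep_mul_repInv, one_mul]

lemma isStab_one [Nonempty n] (ρ : H →ₐ[k] Matrix n n k) : IsStab ρ 1 :=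
  ⟨1, one_ne_zero, by rw [const_one, mul_one, mul_one, char_one, rep_mul_repInv]⟩

/-- The trivial weight vectors of `ρ ⊗ ρ` are the intertwiners between `ρ` and its dual. -/
lemma tensorWeight_one_iff_dual {ρ : H →ₐ[k] Matrix n n k} {X : Matrix n n k} :
    rep ρ * const k H X * tr (rep ρ) = char n 1 * const k H X ↔
      rep ρ * const k H Xᵀ = const k H Xᵀ * rep (dual ρ) := by
  rw [tensorWeight_eq_iff, char_one, mul_one, rep_dual]
  constructor <;> intro h
  · have := congrArg tr h
    rwa [tr_const_mul, tr_mul_const, tr_tr] at this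
  · have := congrArg tr h
    rwa [tr_const_mul, tr_mul_const, tr_tr, transpose_transpose] at this

section Surjective

variable [Nontrivial n] {ρ : H →ₐ[k] Matrix n n k}

lemma eq_zero_of_rep_mul_const (hρ : Function.Surjective ρ) {g : WithConv (H →ₐ[k] k)}
    {W : Matrix n n k} (h : rep ρ * const k H W = char n g * const k H W) : W = 0 := by
  obtain ⟨e, he, hge⟩ := exists_eq_one_character_eq_zero hρ g.ofConv
  simpa [-LinearMap.convMul_apply, he, hge] using congrArg (fun f : ConvRing k H n => f e) h

lemma eq_zero_of_const_mul_rep (hρ : Function.Surjective ρ) {g : WithConv (H →ₐ[k] k)}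
    {W : Matrix n n k} (h : const k H W * rep ρ = char n g * const k H W) : W = 0 := by
  obtain ⟨e, he, hge⟩ := exists_eq_one_character_eq_zero hρ g.ofConv
  simpa [-LinearMap.convMul_apply, he, hge] using congrArg (fun f : ConvRing k H n => f e) h

end Surjective

end General

/-! ### Two-dimensional representations and the order of the stabilizer -/

section Two

variable {k : Type*} {H : Type*} [Field k] [IsAlgClosed k] [Ring H] [HopfAlgebra k H]
  {ρ : H →ₐ[k] Matrix (Fin 2) (Fin 2) k}

lemma surjective_of_no_const
    (h : ∀ (g : WithConv (H →ₐ[k] k)) (W : Matrix (Fin 2) (Fin 2) k),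
      rep ρ * const k H W = char (Fin 2) g * const k H W → W = 0) : Function.Surjective ρ := by
  refine surjective_of_no_common_eigenvector ρ fun g v hv => ?_
  have h0 := h (toConv g) (Matrix.of fun i _ => v i) <| ext fun x => by
    rw [mul_const_apply, char_mul_const_apply]
    ext i j
    exact congrFun (hv x) i
  funext i
  exact congrFun (congrFun h0 i) 0

lemma surjective_twistLeft (hρ : Function.Surjective ρ) (g : WithConv (H →ₐ[k] k)) :
    Function.Surjective (twistLeft g ρ) := by
  refine surjective_of_no_const fun g' W h => ?_
  refine eq_zero_of_rep_mul_const hρ (g := g⁻¹ * g') ?_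
  rw [rep_twistLeft] at h
  rw [char_mul, mul_assoc, ← h, ← mul_assoc, ← mul_assoc, char_inv_mul_char, one_mul]

lemma surjective_twistRight (hρ : Function.Surjective ρ) (g : WithConv (H →ₐ[k] k)) :
    Function.Surjective (twistRight ρ g) := by
  refine surjective_of_no_const fun g' W h => ?_
  refine eq_zero_of_rep_mul_const hρ (g := g' * g⁻¹) ?_
  rw [rep_twistRight, mul_assoc, char_mul_const, ← mul_assoc] at h
  rw [char_mul, mul_assoc, char_mul_const, ← mul_assoc, ← h, mul_assoc, char_mul_char_inv, mul_one]

/-- An eigenvector of ρ* with character g is a row eigenvector of ρ with character g⁻¹, which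
irreducibility of ρ excludes. -/
lemma surjective_dual (hρ : Function.Surjective ρ) : Function.Surjective (dual ρ) := by
  refine surjective_of_no_const fun g W h => ?_
  have h1 : const k H Wᵀ * repInv ρ = char (Fin 2) g * const k H Wᵀ := by
    have := congrArg tr h
    rwa [rep_dual, tr_mul_const, tr_tr, char_mul_const, tr_const_mul, tr_char] at this
  have h2 : const k H Wᵀ * rep ρ = char (Fin 2) g⁻¹ * const k H Wᵀ := by
    have h3 : const k H Wᵀ = char (Fin 2) g * const k H Wᵀ * rep ρ := by
      rw [← h1, mul_assoc, repInv_mul_rep, mul_one]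
    conv_rhs => rw [h3]
    rw [mul_assoc, ← mul_assoc, char_inv_mul_char, one_mul]
  rw [← transpose_transpose W, eq_zero_of_const_mul_rep hρ h2, transpose_zero]

variable [FiniteDimensional k H] (hdim : Module.finrank k H = 16)
  (hG : Nat.card (WithConv (H →ₐ[k] k)) = 8)

include hG in
lemma card_algHom : Nat.card (H →ₐ[k] k) = 8 :=
  (Nat.card_congr (WithConv.equiv (H →ₐ[k] k))).symm.trans hG

include hG in
lemma finite_algHom : Finite (H →ₐ[k] k) :=
  Nat.finite_of_card_ne_zero (by rw [card_algHom hG]; norm_num)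

include hdim hG in
/-- Among three irreducible two-dimensional representations two are equivalent. -/
lemma exists_intertwiner_of_three {ρ₁ ρ₂ ρ₃ : H →ₐ[k] Matrix (Fin 2) (Fin 2) k}
    (h₁ : Function.Surjective ρ₁) (h₂ : Function.Surjective ρ₂) (h₃ : Function.Surjective ρ₃) :
    (∃ X : Matrix (Fin 2) (Fin 2) k, X ≠ 0 ∧ rep ρ₁ * const k H X = const k H X * rep ρ₂) ∨
    (∃ X : Matrix (Fin 2) (Fin 2) k, X ≠ 0 ∧ rep ρ₁ * const k H X = const k H X * rep ρ₃) ∨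
    (∃ X : Matrix (Fin 2) (Fin 2) k, X ≠ 0 ∧ rep ρ₂ * const k H X = const k H X * rep ρ₃) := by
  by_contra! hc
  have := finite_algHom hG
  have key : ∀ {σ τ : H →ₐ[k] Matrix (Fin 2) (Fin 2) k}, Function.Surjective σ →
      Function.Surjective τ →
      (∀ X : Matrix (Fin 2) (Fin 2) k, X ≠ 0 → rep σ * const k H X ≠ const k H X * rep τ) →
      RingHom.ker (σ : H →+* Matrix (Fin 2) (Fin 2) k) ≠
        RingHom.ker (τ : H →+* Matrix (Fin 2) (Fin 2) k) := by
    intro σ τ hσ hτ h hker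
    obtain ⟨X, hX, hX'⟩ := exists_intertwiner_of_ker_eq hσ hτ hker
    exact h X hX.ne_zero (rep_mul_const_eq_iff.2 hX')
  have k₁ := key h₁ h₂ hc.1
  have k₂ := key h₁ h₃ hc.2.1
  have k₃ := key h₂ h₃ hc.2.2
  -- Three inequivalent representations would require dimension at least 8 + 3·4 = 20.
  have := (card_add_card_mul_le ![ρ₁, ρ₂, ρ₃]
    (fun i => by fin_cases i <;> assumption)
    (fun i j hij => by
      fin_cases i <;> fin_cases j <;>
        first | exact absurd rfl hij | assumption | exact Ne.symm (by assumption))).1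
  rw [card_algHom hG, hdim] at this
  simp at this

include hdim hG in
-- The count 8 + 2·4 = 16 is exact, so the surjection of H onto the product of these matrix algebras
-- is injective.
lemma eq_zero_of_forall {σ τ : H →ₐ[k] Matrix (Fin 2) (Fin 2) k}
    (hσ : Function.Surjective σ) (hτ : Function.Surjective τ)
    (h : ∀ X : Matrix (Fin 2) (Fin 2) k, X ≠ 0 → rep σ * const k H X ≠ const k H X * rep τ)
    {x : H} (hx : ∀ g : WithConv (H →ₐ[k] k), g x = 0) (hxσ : σ x = 0) (hxτ : τ x = 0) :
    x = 0 := by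
  have := finite_algHom hG
  have hker : RingHom.ker (σ : H →+* Matrix (Fin 2) (Fin 2) k) ≠
        RingHom.ker (τ : H →+* Matrix (Fin 2) (Fin 2) k) := by
    intro hker
    obtain ⟨X, hX, hX'⟩ := exists_intertwiner_of_ker_eq hσ hτ hker
    exact h X hX.ne_zero (rep_mul_const_eq_iff.2 hX')
  refine (card_add_card_mul_le ![σ, τ] (fun i => by fin_cases i <;> assumption)
    (fun i j hij => by
      fin_cases i <;> fin_cases j <;>
        first | exact absurd rfl hij | assumption | exact Ne.symm (by assumption))).2 ?_ x
      (fun g => hx (toConv g)) (fun i => by fin_cases i <;> assumption)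
  rw [card_algHom hG, hdim]
  simp

include hdim hG in
-- Among ρ, g ⊗ ρ and g' ⊗ ρ the only equivalence left is between the last two; twist it by g⁻¹.
lemma isStab_inv_mul_of_not_isStab (hρ : Function.Surjective ρ) {g g' : WithConv (H →ₐ[k] k)}
    (hg : ¬ IsStab ρ g) (hg' : ¬ IsStab ρ g') : IsStab ρ (g⁻¹ * g') := by
  rcases exists_intertwiner_of_three hdim hG hρ (surjective_twistLeft hρ g)
    (surjective_twistLeft hρ g') with ⟨X, hX, h⟩ | ⟨X, hX, h⟩ | ⟨X, hX, h⟩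
  · exact absurd ⟨X, hX, stab_eq_iff.2 (by rwa [rep_twistLeft] at h)⟩ hg
  · exact absurd ⟨X, hX, stab_eq_iff.2 (by rwa [rep_twistLeft] at h)⟩ hg'
  · refine ⟨X, hX, stab_eq_iff.2 ?_⟩
    rw [rep_twistLeft, rep_twistLeft, mul_assoc] at h
    have := congrArg (char (Fin 2) g⁻¹ * ·) h
    rw [← mul_assoc, char_inv_mul_char, one_mul] at this
    rw [this, char_mul, ← mul_assoc, char_mul_const]
    simp only [mul_assoc]

/-- The weights of `ρ ⊗ ρ*` have linearly independent weight vectors. -/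
lemma linearIndependent_of_isStab (X : {g // IsStab ρ g} → Matrix (Fin 2) (Fin 2) k)
    (hX : ∀ g, X g ≠ 0)
    (hXg : ∀ g, rep ρ * const k H (X g) * repInv ρ = char (Fin 2) g.1 * const k H (X g)) :
    LinearIndependent k X := by
  rw [linearIndependent_iff']
  intro s c hc g hg
  have hsum : ∀ h : H, ∑ i ∈ s, c i • (i.1 h • X i) = 0 := by
    intro h
    let L : Matrix (Fin 2) (Fin 2) k →ₗ[k] Matrix (Fin 2) (Fin 2) k :=
      { toFun := fun Y => (rep ρ * const k H Y * repInv ρ) h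
        map_add' := fun Y Z => by rw [const_add, mul_add, add_mul]; rfl
        map_smul' := fun a Y => by
          rw [const_smul, mul_smul_comm, smul_mul_assoc]; rfl }
    have h1 := congrArg L hc
    rw [map_sum, map_zero] at h1
    rw [← h1]
    refine Finset.sum_congr rfl fun i _ => ?_
    rw [map_smul]
    congr 1
    change _ = (rep ρ * const k H (X i) * repInv ρ) h
    rw [hXg, char_mul_const_apply]
  -- Dedekind's independence of characters, to be applied to each matrix entry of `hsum`.
  have hind : LinearIndependent k (fun g : {g : WithConv (H →ₐ[k] k) // IsStab ρ g} =>
      ((g.1.ofConv : H →* k) : H → k)) := by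
    refine (linearIndependent_monoidHom H k).comp
      (fun g : {g : WithConv (H →ₐ[k] k) // IsStab ρ g} => (g.1.ofConv : H →* k)) ?_
    intro a b hab
    refine Subtype.ext (WithConv.ext (AlgHom.ext fun x => ?_))
    exact DFunLike.congr_fun hab x
  have hcoef : ∀ i j, c g * X g i j = 0 := by
    intro i j
    refine linearIndependent_iff'.1 hind s (fun g => c g * X g i j) ?_ g hg
    funext h
    have := congrFun (congrFun (hsum h) i) j
    simp only [Matrix.sum_apply, Matrix.smul_apply, smul_eq_mul, Matrix.zero_apply] at this
    simp only [Finset.sum_apply, Pi.smul_apply, smul_eq_mul, Pi.zero_apply]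
    rw [← this]
    refine Finset.sum_congr rfl fun i _ => ?_
    change _ * _ * i.1 h = _
    ring
  by_contra hcg
  exact hX g (by ext i j; exact (mul_eq_zero.1 (hcoef i j)).resolve_left hcg)

include hG in
lemma finite_char : Finite (WithConv (H →ₐ[k] k)) :=
  Nat.finite_of_card_ne_zero (by rw [hG]; norm_num)

include hG in
lemma card_isStab_le : Nat.card {g // IsStab ρ g} ≤ 4 := by
  choose X hX hXg using fun g : {g // IsStab ρ g} => g.2
  have := finite_char hG
  have := Fintype.ofFinite {g // IsStab ρ g}
  have h := (linearIndependent_of_isStab X hX hXg).fintype_card_le_finrank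
  rwa [Module.finrank_matrix, Fintype.card_fin, Module.finrank_self,
    ← Nat.card_eq_fintype_card] at h

include hG in
lemma exists_not_isStab : ∃ g, ¬ IsStab ρ g := by
  by_contra! h
  have h1 := card_isStab_le (ρ := ρ) hG
  rw [Nat.card_congr (Equiv.subtypeUnivEquiv h), hG] at h1
  omega

include hdim hG in
-- Left multiplication by g₀⁻¹, for a fixed non-stabilizing g₀, embeds the complement into the
-- stabilizer, which therefore holds at least half of the 8 characters.
lemma card_isStab (hρ : Function.Surjective ρ) : Nat.card {g // IsStab ρ g} = 4 := by
  refine le_antisymm (card_isStab_le hG) ?_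
  have := finite_char hG
  obtain ⟨g₀, hg₀⟩ := exists_not_isStab (ρ := ρ) hG
  have h1 : Nat.card {g // ¬ IsStab ρ g} ≤ Nat.card {g // IsStab ρ g} := by
    refine Nat.card_le_card_of_injective
      (fun g => ⟨g₀⁻¹ * g.1, isStab_inv_mul_of_not_isStab hdim hG hρ hg₀ g.2⟩) ?_
    intro a b hab
    exact Subtype.ext (mul_left_cancel (congrArg Subtype.val hab))
  classical
  have h2 := Nat.card_congr (Equiv.sumCompl fun g => IsStab ρ g)
  rw [Nat.card_sum, hG] at h2
  omega

include hdim hG in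
/-- The matrices are spanned by weight vectors of `ρ ⊗ ρ*`. -/
lemma exists_eq_sum_of_isStab (hρ : Function.Surjective ρ) [Fintype {g // IsStab ρ g}]
    (Y : Matrix (Fin 2) (Fin 2) k) :
    ∃ Z : {g // IsStab ρ g} → Matrix (Fin 2) (Fin 2) k,
      rep ρ * const k H Y * repInv ρ = ∑ g, char (Fin 2) g.1 * const k H (Z g) := by
  choose X hX hXg using fun g : {g // IsStab ρ g} => g.2
  have hspan := (linearIndependent_of_isStab X hX hXg).span_eq_top_of_card_eq_finrank' (by
    rw [← Nat.card_eq_fintype_card, card_isStab hdim hG hρ, Module.finrank_matrix,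
      Fintype.card_fin, Module.finrank_self])
  obtain ⟨c, hc⟩ := (Submodule.mem_span_range_iff_exists_fun k).1
    (hspan ▸ Submodule.mem_top : Y ∈ _)
  refine ⟨fun g => c g • X g, ?_⟩
  let L : Matrix (Fin 2) (Fin 2) k →ₗ[k] ConvRing k H (Fin 2) :=
      { toFun := fun Y => rep ρ * const k H Y * repInv ρ
        map_add' := fun Y Z => by rw [const_add, mul_add, add_mul]
        map_smul' := fun a Y => by
          rw [const_smul, mul_smul_comm, smul_mul_assoc]; rfl }
  have h1 := congrArg L hc
  rw [map_sum] at h1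
  change _ = rep ρ * const k H Y * repInv ρ at h1
  rw [← h1]
  refine Finset.sum_congr rfl fun i _ => ?_
  rw [map_smul, const_smul, mul_smul_comm, ← hXg]
  rfl

end Two

end ConvMatrix

/-! ### Hopf ideals annihilating ρ -/

namespace ConvMatrix

section Vanishing

variable {k : Type*} {H : Type*} {n : Type*} [Field k] [Ring H] [HopfAlgebra k H]
  [Fintype n] [DecidableEq n] {I : Ideal H} {ρ : H →ₐ[k] Matrix n n k}

lemma repInv_vanishes (hI : I.IsHopfIdeal k) (hρ : ∀ h ∈ I, ρ h = 0) :
    ∀ h ∈ I, repInv ρ h = 0 := fun _ hh => hρ _ (hI.antipode_mem hh)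

lemma char_vanishes_of_mul_const {g : WithConv (H →ₐ[k] k)} {X : Matrix n n k} (hX : X ≠ 0)
    (h : ∀ h ∈ I, (char n g * const k H X) h = 0) : ∀ h ∈ I, g h = 0 := by
  intro x hx
  have := h x hx
  rw [char_mul_const_apply] at this
  exact (smul_eq_zero.1 this).resolve_right hX

/-- Up to a nonzero constant, g is a convolution product of ρ, a constant and ρ ∘ S, each of which
vanishes on I. -/
lemma IsStab.vanishes {g : WithConv (H →ₐ[k] k)} (hg : IsStab ρ g) (hI : I.IsHopfIdeal k)
    (hρ : ∀ h ∈ I, ρ h = 0) : ∀ h ∈ I, g h = 0 := by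
  obtain ⟨X, hX, h⟩ := hg
  refine char_vanishes_of_mul_const hX ?_
  rw [← h]
  exact mul_vanishes hI (mul_vanishes hI hρ (const_vanishes hI X)) (repInv_vanishes hI hρ)

lemma IsTensorWeight.vanishes {g : WithConv (H →ₐ[k] k)} (hg : IsTensorWeight ρ g)
    (hI : I.IsHopfIdeal k) (hρ : ∀ h ∈ I, ρ h = 0) : ∀ h ∈ I, g h = 0 := by
  obtain ⟨X, hX, h⟩ := hg
  refine char_vanishes_of_mul_const hX ?_
  rw [← h]
  refine mul_vanishes hI (mul_vanishes hI hρ (const_vanishes hI X)) fun x hx => ?_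
  rw [tr_apply, rep_apply, hρ x hx, transpose_zero]

lemma char_mul_vanishes (hI : I.IsHopfIdeal k) {g g' : WithConv (H →ₐ[k] k)}
    (hg : ∀ h ∈ I, g h = 0) (hg' : ∀ h ∈ I, g' h = 0) : ∀ h ∈ I, (g * g') h = 0 := by
  -- Scalar functions are viewed as 1 × 1 matrices so that `mul_vanishes` applies.
  refine char_vanishes_of_mul_const (n := Fin 1) (one_ne_zero) ?_
  rw [const_one, mul_one, char_mul]
  refine mul_vanishes hI (fun x hx => ?_) (fun x hx => ?_)
  · rw [char_apply, hg x hx, zero_smul]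
  · rw [char_apply, hg' x hx, zero_smul]

end Vanishing

section Two

variable {k : Type*} {H : Type*} [Field k] [IsAlgClosed k] [Ring H] [HopfAlgebra k H]
  {ρ : H →ₐ[k] Matrix (Fin 2) (Fin 2) k} [FiniteDimensional k H]
  (hdim : Module.finrank k H = 16) (hG : Nat.card (WithConv (H →ₐ[k] k)) = 8)

include hdim hG in
-- Two of ρ, ρ* and ρ* ⊗ g are equivalent. The first pair would make ρ self-dual and the last would
-- put g in the stabilizer, so ρ ≅ ρ* ⊗ g.
lemma isTensorWeight_of_not_isStab (hρ : Function.Surjective ρ) (hd : ¬ IsTensorWeight ρ 1)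
    {g : WithConv (H →ₐ[k] k)} (hg : ¬ IsStab ρ g) : IsTensorWeight ρ g := by
  rcases exists_intertwiner_of_three hdim hG hρ (surjective_dual hρ)
    (surjective_twistRight (surjective_dual hρ) g) with ⟨X, hX, h⟩ | ⟨X, hX, h⟩ | ⟨X, hX, h⟩
  · refine absurd ⟨Xᵀ, by simpa using hX, tensorWeight_one_iff_dual.2 ?_⟩ hd
    rwa [transpose_transpose]
  · refine ⟨Xᵀ, by simpa using hX, tensorWeight_eq_iff.2 ?_⟩
    have := congrArg tr h
    rwa [rep_twistRight, rep_dual, tr_mul_const, tr_const_mul, tr_mul_char, tr_tr] at this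
  · refine absurd ⟨Xᵀ, by simpa using hX, stab_eq_iff_dual.2 ?_⟩ hg
    have := congrArg tr h
    rwa [rep_twistRight, rep_dual, tr_mul_const, tr_const_mul, tr_mul_char, tr_tr] at this

include hdim hG in
lemma eq_bot_of_not_isTensorWeight_one (hρ : Function.Surjective ρ)
    (hd : ¬ IsTensorWeight ρ 1) {I : Ideal H} (hI : I.IsHopfIdeal k)
    (hIρ : ∀ h ∈ I, ρ h = 0) : I = ⊥ := by
  refine (Submodule.eq_bot_iff _).2 fun x hx => ?_
  refine eq_zero_of_forall hdim hG hρ (surjective_dual hρ) (fun X hX h => ?_) (fun g => ?_)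
    (hIρ x hx) ?_
  · refine hd ⟨Xᵀ, by simpa using hX, tensorWeight_one_iff_dual.2 ?_⟩
    rwa [transpose_transpose]
  · by_cases hg : IsStab ρ g
    · exact hg.vanishes hI hIρ x hx
    · exact (isTensorWeight_of_not_isStab hdim hG hρ hd hg).vanishes hI hIρ x hx
  · rw [dual_apply, hIρ _ (hI.antipode_mem hx), transpose_zero]

include hdim hG in
lemma eq_bot_of_not_isStab (hρ : Function.Surjective ρ) {g : WithConv (H →ₐ[k] k)}
    (hg : ¬ IsStab ρ g) {I : Ideal H} (hI : I.IsHopfIdeal k)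
    (hIρ : ∀ h ∈ I, ρ h = 0) (hIg : ∀ h ∈ I, g h = 0) : I = ⊥ := by
  refine (Submodule.eq_bot_iff _).2 fun x hx => ?_
  refine eq_zero_of_forall hdim hG hρ (surjective_twistLeft hρ g) (fun X hX h => ?_) (fun g' => ?_)
    (hIρ x hx) ?_
  · exact hg ⟨X, hX, stab_eq_iff.2 (by rwa [rep_twistLeft] at h)⟩
  · by_cases hg' : IsStab ρ g'
    · exact hg'.vanishes hI hIρ x hx
    -- The stabilizer has one other coset: g' is g times the stabilizing character g⁻¹g'.
    · rw [← mul_inv_cancel_left g g']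
      exact char_mul_vanishes hI hIg
        ((isStab_inv_mul_of_not_isStab hdim hG hρ hg hg').vanishes hI hIρ) x hx
  · rw [← rep_apply, rep_twistLeft]
    exact mul_vanishes hI (fun y hy => by rw [char_apply, hIg y hy, zero_smul]) hIρ x hx

/-! ### The group of stabilizing characters and the associated Hopf ideal -/

lemma IsStab.exists_unit (hρ : Function.Surjective ρ) {g : WithConv (H →ₐ[k] k)}
    (hg : IsStab ρ g) : ∃ X Y : Matrix (Fin 2) (Fin 2) k, X * Y = 1 ∧ Y * X = 1 ∧
      rep ρ * const k H X * repInv ρ = char (Fin 2) g * const k H X := by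
  obtain ⟨X, hX, h⟩ := hg
  have h' := h
  rw [stab_eq_iff, ← rep_twistLeft, rep_mul_const_eq_iff] at h'
  obtain ⟨u, rfl⟩ := isUnit_of_intertwiner (surjective_twistLeft hρ g) hX h'
  exact ⟨u, ↑u⁻¹, u.mul_inv, u.inv_mul, h⟩

lemma IsStab.mul (hρ : Function.Surjective ρ) {g g' : WithConv (H →ₐ[k] k)}
    (hg : IsStab ρ g) (hg' : IsStab ρ g') : IsStab ρ (g * g') := by
  obtain ⟨X, X', h1, h2, h⟩ := hg.exists_unit hρ
  obtain ⟨Y, Y', h1', h2', h'⟩ := hg'.exists_unit hρ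
  refine ⟨X * Y, fun h0 => ?_, stab_eq_iff.2 ?_⟩
  · have : X * Y * (Y' * X') = 0 := by rw [h0, zero_mul]
    rw [mul_assoc, ← mul_assoc Y, h1', one_mul, h1] at this
    exact one_ne_zero this
  · rw [stab_eq_iff] at h h'
    rw [← const_mul_const, ← mul_assoc, h, mul_assoc, mul_assoc, h', char_mul]
    simp only [← mul_assoc]
    rw [mul_assoc (const k H X) (char (Fin 2) g), char_mul_const]
    simp only [mul_assoc]

lemma IsStab.inv (hρ : Function.Surjective ρ) {g : WithConv (H →ₐ[k] k)}
    (hg : IsStab ρ g) : IsStab ρ g⁻¹ := by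
  obtain ⟨X, Y, h1, h2, h⟩ := hg.exists_unit hρ
  refine ⟨Y, fun h0 => ?_, stab_eq_iff.2 ?_⟩
  · rw [h0, mul_zero] at h1
    exact one_ne_zero h1.symm
  · rw [stab_eq_iff] at h
    have e1 := const_mul_const_of_mul_eq_one (k := k) (H := H) h1
    have e2 := const_mul_const_of_mul_eq_one (k := k) (H := H) h2
    have h3 : rep ρ = const k H Y * char (Fin 2) g⁻¹ * (rep ρ * const k H X) := by
      rw [h, ← char_mul_const]
      simp only [← mul_assoc]
      rw [mul_assoc (char (Fin 2) g⁻¹) (const k H Y), e2, mul_one, char_inv_mul_char, one_mul]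
    conv_lhs => rw [h3]
    rw [mul_assoc, mul_assoc, mul_assoc, e1, mul_one]

lemma IsTensorWeight.exists_unit (hρ : Function.Surjective ρ) (hd : IsTensorWeight ρ 1) :
    ∃ Q R : Matrix (Fin 2) (Fin 2) k, Q * R = 1 ∧ R * Q = 1 ∧
      tr (rep ρ) = const k H R * repInv ρ * const k H Q := by
  obtain ⟨Q, hQ, h⟩ := hd
  have h' := rep_mul_const_eq_iff.1 (tensorWeight_one_iff_dual.1 h)
  have hu := isUnit_of_intertwiner (surjective_dual hρ) (by simpa using hQ) h'
  rw [isUnit_transpose] at hu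
  obtain ⟨u, rfl⟩ := hu
  refine ⟨u, ↑u⁻¹, u.mul_inv, u.inv_mul, ?_⟩
  rw [tensorWeight_eq_iff, char_one, mul_one] at h
  rw [mul_assoc, ← h, ← mul_assoc, const_mul_const_of_mul_eq_one u.inv_mul, one_mul]

/-- Self-duality conjugates ρᵀ into ρ ∘ S, so right multiplication by `R` or `Q` exchanges the two
kinds of weight vector. -/
lemma isTensorWeight_iff_isStab (hρ : Function.Surjective ρ) (hd : IsTensorWeight ρ 1)
    {g : WithConv (H →ₐ[k] k)} : IsTensorWeight ρ g ↔ IsStab ρ g := by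
  obtain ⟨Q, R, hQR, hRQ, hQ⟩ := hd.exists_unit hρ
  have e1 := const_mul_const_of_mul_eq_one (k := k) (H := H) hQR
  have e2 := const_mul_const_of_mul_eq_one (k := k) (H := H) hRQ
  constructor
  · rintro ⟨X, hX, h⟩
    refine ⟨X * R, fun h0 => hX ?_, ?_⟩
    · rw [← mul_one X, ← hRQ, ← mul_assoc, h0, zero_mul]
    · have := congrArg (· * const k H R) h
      rw [hQ, mul_assoc, mul_assoc _ (const k H Q), e1, mul_one, ← mul_assoc,
        mul_assoc (rep ρ), const_mul_const, mul_assoc (char (Fin 2) g), const_mul_const] at this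
      exact this
  · rintro ⟨X, hX, h⟩
    refine ⟨X * Q, fun h0 => hX ?_, ?_⟩
    · rw [← mul_one X, ← hQR, ← mul_assoc, h0, zero_mul]
    · rw [hQ, ← const_mul_const, ← mul_assoc (char (Fin 2) g), ← h]
      simp only [mul_assoc]
      rw [← mul_assoc (const k H Q) (const k H R), e1, one_mul]

variable (ρ) in
/-- The common kernel of `ρ` and of its stabilizing characters. -/
def stabIdeal : Ideal H :=
  RingHom.ker (ρ.prod (AlgHom.pi fun g : {g // IsStab ρ g} => g.1.ofConv))

instance : (stabIdeal ρ).IsTwoSided := by unfold stabIdeal; infer_instance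

lemma mem_stabIdeal {h : H} : h ∈ stabIdeal ρ ↔ ρ h = 0 ∧ ∀ g, IsStab ρ g → g h = 0 := by
  rw [stabIdeal, RingHom.mem_ker, AlgHom.prod_apply, Prod.mk_eq_zero]
  refine and_congr_right fun _ => ⟨fun h g hg => congrFun h ⟨g, hg⟩, fun h => ?_⟩
  funext g
  exact h g.1 g.2

include hdim hG in
-- The target of the defining map has dimension at most 4 + 4 = 8, less than 16.
lemma stabIdeal_ne_bot : stabIdeal ρ ≠ ⊥ := by
  intro h
  have := finite_char hG
  have := Fintype.ofFinite {g // IsStab ρ g}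
  let ψ := ρ.prod (AlgHom.pi fun g : {g // IsStab ρ g} => g.1.ofConv)
  have hinj : Function.Injective ψ := (RingHom.injective_iff_ker_eq_bot ψ).2 h
  have h1 := LinearMap.finrank_le_finrank_of_injective (f := ψ.toLinearMap) hinj
  rw [hdim, Module.finrank_prod, Module.finrank_matrix, Module.finrank_fintype_fun_eq_card,
    Fintype.card_fin, Module.finrank_self, ← Nat.card_eq_fintype_card] at h1
  have h2 := card_isStab_le (ρ := ρ) hG
  omega

lemma mul_single_mul_transpose_apply (A B : Matrix (Fin 2) (Fin 2) k) (i j a b : Fin 2) :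
    (A * Matrix.single j b (1 : k) * Bᵀ) i a = A i j * B a b := by
  simp [Matrix.mul_apply, Matrix.single_apply, ite_and, Finset.sum_ite_eq]

include hdim hG in
-- By duality it suffices that products of entries of ρ and stabilizing characters vanish on the
-- ideal. Products of two entries reduce to stabilizing characters, and mixed products to entries of
-- ρ.
lemma isHopfIdeal_stabIdeal (hρ : Function.Surjective ρ) (hd : IsTensorWeight ρ 1) :
    (stabIdeal ρ).IsHopfIdeal k := by
  obtain ⟨Q, R, hQR, hRQ, hQ⟩ := hd.exists_unit hρ
  have e1 := const_mul_const_of_mul_eq_one (k := k) (H := H) hQR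
  have e2 := const_mul_const_of_mul_eq_one (k := k) (H := H) hRQ
  have := finite_char hG
  have := Fintype.ofFinite {g // IsStab ρ g}
  have v1 : ∀ h ∈ stabIdeal ρ, ρ h = 0 := fun h hh => (mem_stabIdeal.1 hh).1
  have v2 : ∀ h ∈ stabIdeal ρ, ∀ g, IsStab ρ g → g h = 0 := fun h hh => (mem_stabIdeal.1 hh).2
  have vinv : ∀ h ∈ stabIdeal ρ, repInv ρ h = 0 := by
    have : repInv ρ = const k H Q * tr (rep ρ) * const k H R := by
      rw [hQ]
      simp only [← mul_assoc]
      rw [e1, one_mul, mul_assoc, e1, mul_one]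
    intro h hh
    rw [this, mul_const_apply, const_mul_apply, tr_apply, rep_apply, v1 h hh]
    simp
  have vρρ : ∀ h ∈ stabIdeal ρ, ∀ Y : Matrix (Fin 2) (Fin 2) k,
      (rep ρ * const k H Y * tr (rep ρ)) h = 0 := by
    intro h hh Y
    -- Self-duality replaces ρᵀ by ρ ∘ S, and ρ ⊗ ρ* splits completely into stabilizing characters.
    obtain ⟨Z, hZ⟩ := exists_eq_sum_of_isStab hdim hG hρ (Y * R)
    have : rep ρ * const k H Y * tr (rep ρ) =
        (rep ρ * const k H (Y * R) * repInv ρ) * const k H Q := by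
      rw [hQ, ← const_mul_const]
      simp only [mul_assoc]
    rw [this, mul_const_apply, hZ]
    have h0 : (∑ g : {g // IsStab ρ g}, char (Fin 2) g.1 * const k H (Z g)) h =
        ∑ g : {g // IsStab ρ g}, (char (Fin 2) g.1 * const k H (Z g)) h := by
      rw [WithConv.ofConv_sum, LinearMap.sum_apply]
    rw [h0, Finset.sum_eq_zero, zero_mul]
    intro g _
    rw [char_mul_const_apply, v2 h hh g.1 g.2, zero_smul]
  have vgρ : ∀ h ∈ stabIdeal ρ, ∀ g, IsStab ρ g → (char (Fin 2) g * rep ρ) h = 0 := by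
    intro h hh g hg
    obtain ⟨X, Y, h1, h2, hX⟩ := hg.exists_unit hρ
    have h3 := congrArg (fun f : ConvRing k H (Fin 2) => f h) (stab_eq_iff.1 hX)
    rw [mul_const_apply, const_mul_apply, rep_apply, v1 h hh, zero_mul] at h3
    rw [← one_mul ((char (Fin 2) g * rep ρ) h), ← h2, mul_assoc, ← h3, mul_zero]
  have vρg : ∀ h ∈ stabIdeal ρ, ∀ g, IsStab ρ g → (rep ρ * char (Fin 2) g) h = 0 := by
    intro h hh g hg
    obtain ⟨X, Y, h1, h2, hX⟩ := hg.exists_unit hρ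
    have h3 := congrArg (fun f : ConvRing k H (Fin 2) => f h) (stab_eq_iff_dual.1 hX)
    rw [mul_const_apply, const_mul_apply, vinv h hh, mul_zero] at h3
    have h4 : (repInv ρ * char (Fin 2) g) h = 0 := by
      rw [← mul_one ((repInv ρ * char (Fin 2) g) h), ← h1, ← mul_assoc, ← h3, zero_mul]
    -- The twist of ρ ∘ S by g is known to vanish; self-duality carries this over to ρᵀ, hence to ρ.
    have h5 : tr (rep ρ) * char (Fin 2) g =
        const k H R * (repInv ρ * char (Fin 2) g) * const k H Q := by
      rw [hQ, mul_assoc, ← char_mul_const]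
      simp only [mul_assoc]
    rw [← tr_tr (rep ρ), ← tr_mul_char, h5, tr_apply, mul_const_apply, const_mul_apply, h4]
    simp
  refine { counit_eq_zero := ?_, map_mkQ_comul_eq_zero := ?_, antipode_mem := ?_ }
  · exact fun h hh => v2 h hh 1 (isStab_one ρ)
  · intro h hh
    let J : Submodule k H := (stabIdeal ρ).restrictScalars k
    let β : (H →ₗ[k] k) →ₗ[k] (H →ₗ[k] k) →ₗ[k] k := LinearMap.mk₂ k
      (fun F F' => (toConv F * toConv F') h)
      (fun a b c => by rw [toConv_add, add_mul]; rfl)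
      (fun a b c => by rw [toConv_smul, smul_mul_assoc]; rfl)
      (fun a b c => by rw [toConv_add, mul_add]; rfl)
      (fun a b c => by rw [toConv_smul, mul_smul_comm]; rfl)
    let L : (Fin 2 × Fin 2) ⊕ {g // IsStab ρ g} → H →ₗ[k] k :=
      Sum.elim (fun p => (Matrix.entryLinearMap k k p.1 p.2) ∘ₗ ρ.toLinearMap)
        (fun g => g.1.ofConv.toLinearMap)
    have hβL : ∀ a b, β (L a) (L b) = 0 := by
      let r := Coalgebra.Repr.arbitrary k h
      rintro (⟨i, j⟩ | g) (⟨a, b⟩ | g')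
      -- With this matrix unit in the middle, the (i, a) entry is exactly the convolution of the
      -- entries ρ_ij and ρ_ab.
      · have h1 := congrFun (congrFun (vρρ h hh (Matrix.single j b 1)) i) a
        rw [r.convMul_apply] at h1
        change (toConv _ * toConv _ : WithConv (H →ₗ[k] k)) h = 0
        rw [r.convMul_apply]
        refine Eq.trans ?_ h1
        rw [Matrix.sum_apply]
        refine Finset.sum_congr rfl fun l _ => ?_
        rw [mul_const_apply, tr_apply, rep_apply, rep_apply, mul_single_mul_transpose_apply]
        rfl
      · have h1 := congrFun (congrFun (vρg h hh g'.1 g'.2) i) j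
        rw [r.convMul_apply] at h1
        change (toConv _ * toConv _ : WithConv (H →ₗ[k] k)) h = 0
        rw [r.convMul_apply]
        refine Eq.trans ?_ h1
        rw [Matrix.sum_apply]
        refine Finset.sum_congr rfl fun l _ => ?_
        rw [char_apply, rep_apply, Matrix.mul_smul, mul_one, Matrix.smul_apply, smul_eq_mul,
          mul_comm]
        rfl
      · have h1 := congrFun (congrFun (vgρ h hh g.1 g.2) a) b
        rw [r.convMul_apply] at h1
        change (toConv _ * toConv _ : WithConv (H →ₗ[k] k)) h = 0
        rw [r.convMul_apply]
        refine Eq.trans ?_ h1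
        rw [Matrix.sum_apply]
        refine Finset.sum_congr rfl fun l _ => ?_
        rw [char_apply, rep_apply, Matrix.smul_mul, one_mul, Matrix.smul_apply, smul_eq_mul]
        rfl
      · exact v2 h hh _ (g.2.mul hρ g'.2)
    -- J is the common kernel of the finite family `L`, so every functional killing J lies in its
    -- span.
    have hmem : ∀ f : Module.Dual k (H ⧸ J), f ∘ₗ J.mkQ ∈ Submodule.span k (Set.range L) := by
      intro f
      refine FiniteDimensional.mem_span_of_iInf_ker_le_ker fun x hx => ?_
      rw [Submodule.mem_iInf] at hx
      have hxJ : x ∈ J := mem_stabIdeal.2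
        ⟨by ext i j; exact hx (.inl (i, j)), fun g hg => hx (.inr ⟨g, hg⟩)⟩
      rw [LinearMap.mem_ker, LinearMap.comp_apply, Submodule.mkQ_apply,
        (Submodule.Quotient.mk_eq_zero J).2 hxJ, map_zero]
    have hβ : ∀ F ∈ Submodule.span k (Set.range L), ∀ F' ∈ Submodule.span k (Set.range L),
        β F F' = 0 := by
      intro F hF F' hF'
      have h1 : Submodule.span k (Set.range L) ≤ LinearMap.ker (β F) := by
        rw [Submodule.span_le]
        rintro _ ⟨b, rfl⟩
        have h2 : Submodule.span k (Set.range L) ≤ LinearMap.ker (β.flip (L b)) := by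
          rw [Submodule.span_le]
          rintro _ ⟨a, rfl⟩
          exact hβL a b
        exact h2 hF
      exact h1 hF'
    -- Vanishing in H/J ⊗ H/J is tested on functionals, which by finite dimension are sums of pure
    -- tensors.
    refine (Module.forall_dual_apply_eq_zero_iff k _).1 fun φ => ?_
    obtain ⟨y, rfl⟩ := (TensorProduct.dualDistribEquiv k (H ⧸ J) (H ⧸ J)).surjective φ
    induction y with
    | zero => simp
    | add a b ha hb => rw [map_add, LinearMap.add_apply, ha, hb, add_zero]
    | tmul f f' =>
      have h1 := hβ _ (hmem f) _ (hmem f')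
      change LinearMap.mul' k k (TensorProduct.map (f ∘ₗ J.mkQ) (f' ∘ₗ J.mkQ) (comul h)) = 0 at h1
      rw [TensorProduct.map_comp] at h1
      exact h1
  · intro h hh
    exact mem_stabIdeal.2 ⟨vinv h hh, fun g hg => v2 h hh g⁻¹ (hg.inv hρ)⟩

end Two

end ConvMatrix

/-! ### Group-like elements of the dual coalgebra -/

section GroupLike

variable {k : Type*} {H : Type*} [Field k] [Ring H] [Algebra k H] [Module.Finite k H]

lemma HopfDual.isGroupLikeElem_iff (f : HopfDual k H) :
    IsGroupLikeElem k f ↔ f 1 = 1 ∧ ∀ a b, f (a * b) = f a * f b := by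
  rw [_root_.isGroupLikeElem_iff, HopfDual.counit_def]
  refine and_congr_right fun _ => ⟨fun h a b => ?_, fun h => ?_⟩
  · rw [← HopfDual.pairing_comul, h, HopfDual.pairing_tmul]
  · refine (HopfDual.pairing k H).injective (TensorProduct.ext' fun a b => ?_)
    rw [HopfDual.pairing_comul, h, HopfDual.pairing_tmul]

variable (k H) in
/-- Group-like elements of `H*` are the characters of `H`. -/
def HopfDual.groupLikeEquiv : GroupLike k (HopfDual k H) ≃ (H →ₐ[k] k) where
  toFun f := AlgHom.ofLinearMap f.val
    ((HopfDual.isGroupLikeElem_iff f.val).1 f.isGroupLikeElem_val).1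
    ((HopfDual.isGroupLikeElem_iff f.val).1 f.isGroupLikeElem_val).2
  invFun g := ⟨g.toLinearMap, (HopfDual.isGroupLikeElem_iff _).2 ⟨map_one g, map_mul g⟩⟩
  left_inv _ := rfl
  right_inv _ := rfl

end GroupLike

/-! ### The matrix representation of a module with a basis -/

section ModuleRep

variable {k : Type*} {H : Type*} {n : Type*} {V : Type*} {W : Type*} [Field k] [Ring H]
  [Algebra k H] [Fintype n] [DecidableEq n]
  [AddCommGroup V] [Module k V] [Module H V] [IsScalarTower k H V]
  [AddCommGroup W] [Module k W] [Module H W] [IsScalarTower k H W]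

variable (H) in
/-- The matrix representation afforded by a module with a basis. -/
def Module.Basis.matrixRep (b : Module.Basis n k V) : H →ₐ[k] Matrix n n k :=
  (LinearMap.toMatrixAlgEquiv b).toAlgHom.comp (Algebra.lsmul k k V)

lemma Module.Basis.matrixRep_def (b : Module.Basis n k V) (h : H) :
    b.matrixRep H h = LinearMap.toMatrix b b (Algebra.lsmul k k V h) := rfl

lemma Module.Basis.matrixRep_apply (b : Module.Basis n k V) (h : H) (i j : n) :
    b.matrixRep H h i j = b.repr (h • b j) i := by
  rw [Module.Basis.matrixRep_def, LinearMap.toMatrix_apply]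
  rfl

lemma Module.Basis.matrixRep_eq_zero_iff (b : Module.Basis n k V) (h : H) :
    b.matrixRep H h = 0 ↔ ∀ x : V, h • x = 0 := by
  rw [Module.Basis.matrixRep_def, LinearEquiv.map_eq_zero_iff, LinearMap.ext_iff]
  rfl

lemma Module.Basis.matrixRep_surjective [IsAlgClosed k] [IsSimpleModule H V]
    (b : Module.Basis n k V) : Function.Surjective (b.matrixRep H) := by
  intro A
  have : FiniteDimensional k V := b.finiteDimensional_of_finite
  obtain ⟨h, hh⟩ := exists_smul_eq_of_isSimpleModule (H := H) (LinearMap.toMatrix b b |>.symm A)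
  refine ⟨h, ?_⟩
  rw [Module.Basis.matrixRep_def, ← LinearEquiv.eq_symm_apply]
  exact LinearMap.ext hh

lemma Module.Basis.matrixRep_mul_toMatrix_iff (b : Module.Basis n k V) (c : Module.Basis n k W)
    (T : W →ₗ[k] V) (h : H) :
    b.matrixRep H h * LinearMap.toMatrix c b T = LinearMap.toMatrix c b T * c.matrixRep H h ↔
      ∀ x, h • T x = T (h • x) := by
  rw [Module.Basis.matrixRep_def, Module.Basis.matrixRep_def, ← LinearMap.toMatrix_comp,
    ← LinearMap.toMatrix_comp, EmbeddingLike.apply_eq_iff_eq, LinearMap.ext_iff]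
  rfl

/-- Modules are isomorphic if and only if their matrix representations are equivalent. -/
lemma Module.Basis.nonempty_linearEquiv_iff (b : Module.Basis n k V) (c : Module.Basis n k W) :
    Nonempty (W ≃ₗ[H] V) ↔ ∃ X : Matrix n n k, IsUnit X ∧
      ∀ h, b.matrixRep H h * X = X * c.matrixRep H h := by
  constructor
  · rintro ⟨e⟩
    let T : W ≃ₗ[k] V := e.restrictScalars k
    refine ⟨LinearMap.toMatrix c b T.toLinearMap, ?_, fun h => ?_⟩
    · refine ⟨⟨_, LinearMap.toMatrix b c T.symm.toLinearMap, ?_, ?_⟩, rfl⟩ <;>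
        rw [← LinearMap.toMatrix_comp] <;> simp
    · rw [Module.Basis.matrixRep_mul_toMatrix_iff]
      exact fun x => (e.map_smul h x).symm
  · rintro ⟨X, ⟨u, rfl⟩, hX⟩
    let T : W →ₗ[k] V := (LinearMap.toMatrix c b).symm u
    let T' : V →ₗ[k] W := (LinearMap.toMatrix b c).symm ↑u⁻¹
    have hT : ∀ (h : H) x, h • T x = T (h • x) := fun h => by
      rw [← Module.Basis.matrixRep_mul_toMatrix_iff b c, LinearEquiv.apply_symm_apply]
      exact hX h
    have h1 : T ∘ₗ T' = LinearMap.id := (LinearMap.toMatrix b b).injective <| by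
      rw [LinearMap.toMatrix_comp b c b, LinearEquiv.apply_symm_apply,
        LinearEquiv.apply_symm_apply, u.mul_inv, LinearMap.toMatrix_id]
    have h2 : T' ∘ₗ T = LinearMap.id := (LinearMap.toMatrix c c).injective <| by
      rw [LinearMap.toMatrix_comp c b c, LinearEquiv.apply_symm_apply,
        LinearEquiv.apply_symm_apply, u.inv_mul, LinearMap.toMatrix_id]
    exact ⟨{ T with
      map_smul' := fun h x => (hT h x).symm
      invFun := T'
      left_inv := LinearMap.congr_fun h2
      right_inv := LinearMap.congr_fun h1 }⟩

end ModuleRep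

/-! ### Duals, tensor squares and direct summands in matrix form -/

section HopfModules

open ConvMatrix

variable {k : Type*} {H : Type*} {V : Type*} [Field k] [Ring H] [HopfAlgebra k H]
  [AddCommGroup V] [Module k V] [Module H V] [IsScalarTower k H V]

section

variable {n : Type*} [Fintype n] [DecidableEq n]

variable (H) in
/-- The dual basis as a basis of the dual module. -/
def Module.Basis.hopfDual (b : Module.Basis n k V) : Module.Basis n k (HopfDualModule k H V) :=
  b.dualBasis

lemma Module.Basis.matrixRep_hopfDual (b : Module.Basis n k V) :
    (b.hopfDual H).matrixRep H = dual (b.matrixRep H) := by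
  refine AlgHom.ext fun h => ?_
  ext i j
  rw [Module.Basis.matrixRep_apply, dual_apply, Matrix.transpose_apply,
    Module.Basis.matrixRep_apply]
  exact (b.dualBasis_repr _ i).trans (b.dualBasis_apply j _)

lemma HopfTensor.smul_tmul_eq_sum {W : Type*} [AddCommGroup W] [Module k W] [Module H W]
    [IsScalarTower k H W] {h : H} {ι : Type*} (r : Coalgebra.Repr k h ι) (x : V) (y : W) :
    h • (show HopfTensor k H V W from x ⊗ₜ[k] y) =
      (show HopfTensor k H V W from ∑ i ∈ r.index, (r.left i • x) ⊗ₜ[k] (r.right i • y)) := by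
  change HopfTensor.actionHom k H V W h (x ⊗ₜ[k] y) = _
  rw [HopfTensor.actionHom, AlgHom.comp_apply, AlgHom.comp_apply, Bialgebra.comulAlgHom_apply,
    ← r.eq, map_sum, map_sum, LinearMap.sum_apply]
  rfl

variable (H) in
/-- The coefficient matrix of an element of `V ⊗ V`. -/
def Module.Basis.tensorMatrix (b : Module.Basis n k V) :
    HopfTensor k H V V ≃ₗ[k] Matrix n n k :=
  (b.tensorProduct b).equivFun.trans (LinearEquiv.curry k k n n)

lemma Module.Basis.tensorMatrix_tmul (b : Module.Basis n k V) (x y : V) :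
    b.tensorMatrix H (show HopfTensor k H V V from x ⊗ₜ[k] y) =
      Matrix.vecMulVec (b.repr x) (b.repr y) := by
  ext i j
  change (b.tensorProduct b).repr (x ⊗ₜ[k] y) (i, j) = _
  rw [Module.Basis.tensorProduct_repr_tmul_apply, Matrix.vecMulVec_apply, smul_eq_mul, mul_comm]

lemma Module.Basis.repr_smul_eq_mulVec (b : Module.Basis n k V) (h : H) (x : V) :
    (b.repr (h • x) : n → k) = b.matrixRep H h *ᵥ b.repr x := by
  rw [Module.Basis.matrixRep_def, LinearMap.toMatrix_mulVec_repr]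
  rfl

/-- On a pure tensor the coefficient matrix is the rank-one matrix x yᵀ, so the second coproduct leg
acts by a transpose on the right. -/
lemma Module.Basis.tensorMatrix_smul (b : Module.Basis n k V) (h : H) (t : HopfTensor k H V V) :
    b.tensorMatrix H (h • t) = (rep (b.matrixRep H) * const k H (b.tensorMatrix H t) *
      tr (rep (b.matrixRep H))) h := by
  let r := Coalgebra.Repr.arbitrary k h
  rw [r.convMul_apply]
  simp only [mul_const_apply, rep_apply, tr_apply]
  refine TensorProduct.induction_on (motive := fun t : V ⊗[k] V =>
    b.tensorMatrix H (h • (show HopfTensor k H V V from t)) = ∑ i ∈ r.index,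
      b.matrixRep H (r.left i) * b.tensorMatrix H (show HopfTensor k H V V from t) *
        (b.matrixRep H (r.right i))ᵀ) t ?_ ?_ ?_
  · change b.tensorMatrix H (h • (0 : HopfTensor k H V V)) = ∑ i ∈ r.index,
      b.matrixRep H (r.left i) * b.tensorMatrix H (0 : HopfTensor k H V V) *
        (b.matrixRep H (r.right i))ᵀ
    simp
  · intro x y
    rw [HopfTensor.smul_tmul_eq_sum r]
    refine (map_sum (b.tensorMatrix H) _ _).trans (Finset.sum_congr rfl fun i _ => ?_)
    refine (b.tensorMatrix_tmul _ _).trans ?_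
    rw [b.tensorMatrix_tmul, Matrix.mul_vecMulVec, Matrix.vecMulVec_mul, Matrix.vecMul_transpose,
      b.repr_smul_eq_mulVec, b.repr_smul_eq_mulVec]
  · intro x y hx hy
    have e1 : b.tensorMatrix H (h • (show HopfTensor k H V V from x + y)) =
        b.tensorMatrix H (h • (show HopfTensor k H V V from x)) +
        b.tensorMatrix H (h • (show HopfTensor k H V V from y)) := by
      rw [← map_add, ← smul_add]
      rfl
    have e2 : b.tensorMatrix H (show HopfTensor k H V V from x + y) =
        b.tensorMatrix H (show HopfTensor k H V V from x) +
        b.tensorMatrix H (show HopfTensor k H V V from y) := map_add _ _ _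
    rw [e1, hx, hy, e2, ← Finset.sum_add_distrib]
    exact Finset.sum_congr rfl fun i _ => by rw [mul_add, add_mul]

lemma Module.Basis.isTensorWeight_iff (b : Module.Basis n k V) (g : WithConv (H →ₐ[k] k)) :
    IsTensorWeight (b.matrixRep H) g ↔ ∃ t : HopfTensor k H V V, t ≠ 0 ∧ ∀ h, h • t = g h • t := by
  have key : ∀ (t : HopfTensor k H V V) h, h • t = g h • t ↔
      (rep (b.matrixRep H) * const k H (b.tensorMatrix H t) * tr (rep (b.matrixRep H))) h =
        (char n g * const k H (b.tensorMatrix H t)) h := fun t h => by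
    rw [← b.tensorMatrix_smul, char_mul_const_apply, ← map_smul, EmbeddingLike.apply_eq_iff_eq]
  constructor
  · rintro ⟨X, hX, h⟩
    obtain ⟨t, rfl⟩ := (b.tensorMatrix H).surjective X
    exact ⟨t, fun h0 => hX (by rw [h0, map_zero]), fun x => (key t x).2 (by rw [h])⟩
  · rintro ⟨t, ht, h⟩
    exact ⟨b.tensorMatrix H t, (LinearEquiv.map_ne_zero_iff _).2 ht,
      ConvMatrix.ext fun x => (key t x).1 (h x)⟩

end

/-- A weight vector t and a generator of φ have the same annihilator, ker g, so Ht ≅ φ;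
semisimplicity supplies the complement. -/
lemma isDirectSummandOf_iff_exists_weight [IsSemisimpleRing H] {φ : Type*} [AddCommGroup φ]
    [Module k φ] [Module H φ] [IsScalarTower k H φ] (hφ : Module.finrank k φ = 1)
    {g : H →ₐ[k] k} (hg : ∀ (h : H) (x : φ), h • x = g h • x) :
    IsDirectSummandOf H φ V ↔ ∃ t : V, t ≠ 0 ∧ ∀ h : H, h • t = g h • t := by
  obtain ⟨x, hx, hspan⟩ := finrank_eq_one_iff'.1 hφ
  constructor
  · rintro ⟨A, B, -, ⟨e⟩⟩
    refine ⟨e x, fun h0 => hx ?_, fun h => ?_⟩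
    · rwa [ZeroMemClass.coe_eq_zero, LinearEquiv.map_eq_zero_iff] at h0
    · rw [← Submodule.coe_smul, ← map_smul, hg, ← algebraMap_smul H (g h) x, map_smul,
        Submodule.coe_smul, algebraMap_smul]
  · rintro ⟨t, ht, hgt⟩
    let f := LinearMap.toSpanSingleton H φ x
    let f' := LinearMap.toSpanSingleton H V t
    have hf : Function.Surjective f := fun y => by
      obtain ⟨c, rfl⟩ := hspan y
      exact ⟨algebraMap k H c, by rw [LinearMap.toSpanSingleton_apply, algebraMap_smul]⟩
    have hker : LinearMap.ker f = LinearMap.ker f' := by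
      ext h
      rw [LinearMap.mem_ker, LinearMap.mem_ker, LinearMap.toSpanSingleton_apply,
        LinearMap.toSpanSingleton_apply, hg, hgt, smul_eq_zero_iff_left hx,
        smul_eq_zero_iff_left ht]
    obtain ⟨B, hB⟩ := exists_isCompl (LinearMap.range f')
    exact ⟨LinearMap.range f', B, hB, ⟨(f.quotKerEquivOfSurjective hf).symm.trans
      ((Submodule.quotEquivOfEq _ _ hker).trans f'.quotKerEquivRange)⟩⟩

/-- A two-dimensional simple module is self-dual if and only if the trivial character is a weight
of its tensor square. -/
lemma Module.Basis.nonempty_hopfDual_equiv_iff [IsAlgClosed k] [IsSimpleModule H V]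
    (b : Module.Basis (Fin 2) k V) :
    Nonempty (HopfDualModule k H V ≃ₗ[H] V) ↔ IsTensorWeight (b.matrixRep H) 1 := by
  rw [Module.Basis.nonempty_linearEquiv_iff b (b.hopfDual H), Module.Basis.matrixRep_hopfDual]
  have hs := b.matrixRep_surjective (H := H)
  constructor
  · rintro ⟨X, hX, h⟩
    refine ⟨Xᵀ, by simpa using hX.ne_zero, tensorWeight_one_iff_dual.2 ?_⟩
    rw [transpose_transpose]
    exact rep_mul_const_eq_iff.2 h
  · rintro ⟨X, hX, h⟩
    have h' := rep_mul_const_eq_iff.1 (tensorWeight_one_iff_dual.1 h)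
    exact ⟨Xᵀ, isUnit_of_intertwiner (surjective_dual hs) (by simpa using hX) h', h'⟩

end HopfModules

end

theorem mainTheorem10 {H : Type*} [Ring H] [HopfAlgebra ℂ H] [Module.Finite ℂ H]
    [IsSemisimpleRing H] (hdim : Module.finrank ℂ H = 16)
    (hG : Nat.card (GroupLike ℂ (HopfDual ℂ H)) = 8)
    {π : Type*} [AddCommGroup π] [Module ℂ π] [Module H π] [IsScalarTower ℂ H π]
    [IsSimpleModule H π] (hπ : Module.finrank ℂ π = 2) :
    (IsInnerFaithful ℂ H π ↔ ¬ Nonempty (HopfDualModule ℂ H π ≃ₗ[H] π)) ∧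
    (Nonempty (HopfDualModule ℂ H π ≃ₗ[H] π) →
      ∀ (φ : Type*) [AddCommGroup φ] [Module ℂ φ] [Module H φ] [IsScalarTower ℂ H φ],
        Module.finrank ℂ φ = 1 →
          (IsInnerFaithful ℂ H (π × φ) ↔
            ¬ IsDirectSummandOf H φ (HopfTensor ℂ H π π))) := by
  have hG' : Nat.card (WithConv (H →ₐ[ℂ] ℂ)) = 8 := by
    rw [← hG]
    exact Nat.card_congr ((WithConv.equiv _).trans (HopfDual.groupLikeEquiv ℂ H).symm)
  have : FiniteDimensional ℂ π := FiniteDimensional.of_finrank_pos (by omega)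
  let b : Module.Basis (Fin 2) ℂ π := Module.finBasisOfFinrankEq ℂ π hπ
  have hs := b.matrixRep_surjective (H := H)
  have hz := b.matrixRep_eq_zero_iff (H := H)
  rw [b.nonempty_hopfDual_equiv_iff]
  refine ⟨⟨fun hf hd => ?_, fun hd I _ hI hIπ => ?_⟩, fun hd φ _ _ _ _ hφ => ?_⟩
  · exact ConvMatrix.stabIdeal_ne_bot hdim hG' (hf _ inferInstance
      (ConvMatrix.isHopfIdeal_stabIdeal hdim hG' hs hd)
      fun h hh => (hz h).1 (ConvMatrix.mem_stabIdeal.1 hh).1)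
  · exact ConvMatrix.eq_bot_of_not_isTensorWeight_one hdim hG' hs hd hI
      fun h hh => (hz h).2 (hIπ h hh)
  · obtain ⟨g, hg⟩ := exists_character_of_finrank_eq_one (H := H) hφ
    obtain ⟨x, hx, -⟩ := finrank_eq_one_iff'.1 hφ
    -- Self-duality of π is used here to exchange weights of π ⊗ π for stabilizing characters.
    have hw : IsDirectSummandOf H φ (HopfTensor ℂ H π π) ↔
        ConvMatrix.IsStab (b.matrixRep H) (WithConv.toConv g) := by
      rw [isDirectSummandOf_iff_exists_weight hφ hg,
        ← ConvMatrix.isTensorWeight_iff_isStab hs hd, b.isTensorWeight_iff]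
    rw [hw]
    refine ⟨fun hf hgs => ?_, fun hgs I _ hI hIπφ => ?_⟩
    · refine ConvMatrix.stabIdeal_ne_bot hdim hG' (hf _ inferInstance
        (ConvMatrix.isHopfIdeal_stabIdeal hdim hG' hs hd) fun h hh p => ?_)
      have h0 : g h = 0 := (ConvMatrix.mem_stabIdeal.1 hh).2 _ hgs
      exact Prod.ext ((hz h).1 (ConvMatrix.mem_stabIdeal.1 hh).1 p.1)
        ((hg h p.2).trans (by rw [h0, zero_smul]; rfl))
    · refine ConvMatrix.eq_bot_of_not_isStab hdim hG' hs hgs hI (fun h hh => ?_) (fun h hh => ?_)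
      · exact (hz h).2 fun y => congrArg Prod.fst (hIπφ h hh (y, 0))
      · have := congrArg Prod.snd (hIπφ h hh (0, x))
        exact (smul_eq_zero.1 ((hg h x).symm.trans this)).resolve_right hx
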